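/- Theorem (cf. Fujimoto). For every odd integer $n\ge 3$ there is a pseudo-algebraic minimal surface in $\mathbb{R}^n$ whose Gauss map is linearly nondegenerate and omits $n(n+1)/2$ hyperplanes of $\mathbb{P}^{n-1}(\mathbb{C})$ located in general position; moreover, the surface can be chosen to be defined on the universal covering of a finitely punctured plane $\mathbb{C}\setminus A$, $A$ finite and nonempty. Here the notions are as follows. For a conformal immersion $x=(x^1,\dots,x^n)\colon X\to\mathbb{R}^n$ of a Riemann surface, $\partial x^i/\partial z=\partial x^i/\partial u-\sqrt{-1}\,\partial x^i/\partial v$ for a local coordinate $z=u+\sqrt{-1}v$, $\phi_i=(\partial x^i/\partial z)\,dz$, and the Gauss map is $g=(\partial x^1/\partial z:\cdots:\partial x^n/\partial z)\colon X\to\mathbb{P}^{n-1}(\mathbb{C})$. The surface is minimal if its mean curvature vanishes at every point in every normal direction. A complete minimal surface $x\colon X\to\mathbb{R}^n$ (that is, one whose induced metric is complete) is pseudo-algebraic if there are a compact Riemann surface $\overline{M}$, finitely many points $p_1,\dots,p_k\in\overline{M}$ and a holomorphic covering map $\pi\colon X\to M=\overline{M}\setminus\{p_1,\dots,p_k\}$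 such that every $\phi_i$ is the pull-back under $\pi$ of a holomorphic $1$-form on $M$ that extends to a meromorphic $1$-form on $\overline{M}$; $M$ is called the basic domain. The additional assertion means that $X$ is simply connected and $M$ is biholomorphic to some $\mathbb{C}\setminus A$ with $A$ finite and nonempty. The map $g$ is linearly nondegenerate if its image lies in no hyperplane, it omits a hyperplane $H$ if $g(X)\cap H=\emptyset$, and hyperplanes $H_1,\dots,H_q$ are in general position if any $n$ of the linear forms defining them are linearly independent. -/

import Mathlib

open scoped Manifold ContDiff Topology

noncomputable section

/-- A Riemann surface: a connected Hausdorff complex manifold of complex dimension one. -/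
class RiemannSurface (X : Type*) [TopologicalSpace X] [ChartedSpace ℂ X] : Prop
    extends IsManifold 𝓘(ℂ) ω X, T2Space X, ConnectedSpace X

namespace MinimalSurface

section Surface

variable {X : Type*} [TopologicalSpace X] [ChartedSpace ℂ X] {n : ℕ}

/-- The expression of `x` in the local coordinate `z = u + iv` given by the preferred chart
at `p`. -/
def localExpr (x : X → EuclideanSpace ℝ (Fin n)) (p : X) : ℂ → EuclideanSpace ℝ (Fin n) :=
  x ∘ (chartAt ℂ p).symm

/-- The derivative of `x` at `p` along the coordinate direction `a`: it is `∂x/∂u` for `a = 1`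
and `∂x/∂v` for `a = i`. -/
def partialDeriv (x : X → EuclideanSpace ℝ (Fin n)) (p : X) (a : ℂ) : EuclideanSpace ℝ (Fin n) :=
  fderiv ℝ (localExpr x p) (chartAt ℂ p p) a

/-- The second derivative of `x` at `p` along the coordinate directions `a` and `b`. -/
def partialDeriv₂ (x : X → EuclideanSpace ℝ (Fin n)) (p : X) (a b : ℂ) :
    EuclideanSpace ℝ (Fin n) :=
  fderiv ℝ (fun w => fderiv ℝ (localExpr x p) w b) (chartAt ℂ p p) a

/-- Coefficients of the first fundamental form at `p`. -/
def firstForm (x : X → EuclideanSpace ℝ (Fin n)) (p : X) (a b : ℂ) : ℝ :=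
  inner ℝ (partialDeriv x p a) (partialDeriv x p b)

/-- Coefficients of the second fundamental form at `p` with respect to the vector `N`. -/
def secondForm (x : X → EuclideanSpace ℝ (Fin n)) (p : X) (N : EuclideanSpace ℝ (Fin n))
    (a b : ℂ) : ℝ :=
  inner ℝ (partialDeriv₂ x p a b) N

/-- The mean curvature at `p` for the normal direction `N`. -/
def meanCurvature (x : X → EuclideanSpace ℝ (Fin n)) (p : X) (N : EuclideanSpace ℝ (Fin n)) : ℝ :=
  (firstForm x p 1 1 * secondForm x p N Complex.I Complex.I
      + firstForm x p Complex.I Complex.I * secondForm x p N 1 1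
      - 2 * firstForm x p 1 Complex.I * secondForm x p N 1 Complex.I) /
    (2 * (firstForm x p 1 1 * firstForm x p Complex.I Complex.I - firstForm x p 1 Complex.I ^ 2))

/-- `x` is a smooth immersion and the complex structure of `X` is the one given by the induced
metric, i.e. the complex coordinates are (positively oriented) isothermal coordinates. -/
structure IsConformalImmersion (x : X → EuclideanSpace ℝ (Fin n)) : Prop where
  smooth : ContMDiff 𝓘(ℝ, ℂ) 𝓘(ℝ, EuclideanSpace ℝ (Fin n)) ∞ x
  immersion : ∀ p, LinearIndependent ℝ ![partialDeriv x p 1, partialDeriv x p Complex.I]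
  conformal : ∀ p, firstForm x p 1 1 = firstForm x p Complex.I Complex.I ∧
    firstForm x p 1 Complex.I = 0

/-- The mean curvature vanishes at all points in all normal directions. -/
def IsMinimal (x : X → EuclideanSpace ℝ (Fin n)) : Prop :=
  ∀ (p : X) (N : EuclideanSpace ℝ (Fin n)),
    inner ℝ N (partialDeriv x p 1) = 0 → inner ℝ N (partialDeriv x p Complex.I) = 0 →
      meanCurvature x p N = 0

/-- The metric induced by `x` is complete: every piecewise continuously differentiable curve
`γ : [0, 1) → X` that leaves every compact set as `t → 1` has infinite length. The length of `γ`
in the induced metric is that of `x ∘ γ`; `P` is the set of break points. -/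
def IsCompleteSurface (x : X → EuclideanSpace ℝ (Fin n)) : Prop :=
  ∀ (γ : ℝ → X) (P : Set ℝ),
    ContinuousOn γ (Set.Ico 0 1) →
    (∀ b < 1, (P ∩ Set.Icc 0 b).Finite) →
    (∀ t ∈ Set.Ioo (0 : ℝ) 1 \ P, ContMDiffAt 𝓘(ℝ, ℝ) 𝓘(ℝ, ℂ) 1 γ t) →
    Filter.Tendsto γ (𝓝[<] 1) (Filter.cocompact X) →
    ∫⁻ t in Set.Ico (0 : ℝ) 1, ‖deriv (x ∘ γ) t‖ₑ = ⊤

/-- The vector `∂x/∂z = ∂x/∂u - i ∂x/∂v` at `p`, with respect to the preferred chart at `p`. -/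
def gaussVector (x : X → EuclideanSpace ℝ (Fin n)) (p : X) : Fin n → ℂ :=
  fun i => (partialDeriv x p 1 i : ℂ) - Complex.I * (partialDeriv x p Complex.I i : ℂ)

theorem gaussVector_ne_zero {x : X → EuclideanSpace ℝ (Fin n)} (hx : IsConformalImmersion x)
    (p : X) : gaussVector x p ≠ 0 := by
  intro h
  have h0 := (hx.immersion p).ne_zero 0
  apply h0
  ext i
  have hi := congrArg Complex.re (congrFun h i)
  simpa [gaussVector] using hi

/-- The Gauss map `p ↦ [∂x/∂u - i ∂x/∂v]` into the complex projective space of dimension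
`n - 1`. -/
def gaussMap {x : X → EuclideanSpace ℝ (Fin n)} (hx : IsConformalImmersion x) (p : X) :
    Projectivization ℂ (Fin n → ℂ) :=
  Projectivization.mk ℂ (gaussVector x p) (gaussVector_ne_zero hx p)

/-- The form `φ i = (∂x i/∂z) dz` on `X`. The tangent space at `p` is `ℂ`, through the preferred
chart at `p`, so that `dz` is the identity there. -/
def weierstrassForm (x : X → EuclideanSpace ℝ (Fin n)) (i : Fin n) (p : X) :
    TangentSpace 𝓘(ℂ) p →L[ℂ] ℂ :=
  gaussVector x p i • ContinuousLinearMap.id ℂ ℂ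

end Surface

section Forms

variable {M : Type*} [TopologicalSpace M] [ChartedSpace ℂ M]

/-- The coefficient `f` of a form `f dz` of type (1,0) in the preferred chart at `p`. -/
def formCoeff (η : (q : M) → TangentSpace 𝓘(ℂ) q →L[ℂ] ℂ) (p : M) : ℂ → ℂ :=
  fun w => η ((chartAt ℂ p).symm w) (mfderiv 𝓘(ℂ) 𝓘(ℂ) (chartAt ℂ p).symm w (1 : ℂ))

/-- Holomorphic at all points of `S`. -/
def IsHolomorphicFormOn (η : (q : M) → TangentSpace 𝓘(ℂ) q →L[ℂ] ℂ) (S : Set M) : Prop :=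
  ∀ p ∈ S, AnalyticAt ℂ (formCoeff η p) (chartAt ℂ p p)

/-- Meromorphic on all of `M` (the values at poles are irrelevant). -/
def IsMeromorphicForm (η : (q : M) → TangentSpace 𝓘(ℂ) q →L[ℂ] ℂ) : Prop :=
  ∀ p, MeromorphicAt (formCoeff η p) (chartAt ℂ p p)

/-- The open subset `Eᶜ` of `M` is biholomorphic to the plane punctured at a finite nonempty
set of points. -/
def IsPuncturedPlane (E : Set M) : Prop :=
  ∃ (A : Finset ℂ) (j : ℂ → M), A.Nonempty ∧
    MDifferentiableOn 𝓘(ℂ) 𝓘(ℂ) j (A : Set ℂ)ᶜ ∧ Set.BijOn j (A : Set ℂ)ᶜ Eᶜ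

end Forms

/-- `x` is a pseudo-algebraic minimal surface with basic domain `M = Mbar \ E`, defined on the
covering surface `π : X → M`: it is a complete minimal surface, and its forms `φ i` are pulled back
from forms that are holomorphic on `M` and meromorphic on the compact Riemann surface `Mbar`. -/
structure IsPseudoAlgebraic {X Mbar : Type*} [TopologicalSpace X] [ChartedSpace ℂ X]
    [RiemannSurface X] [TopologicalSpace Mbar] [ChartedSpace ℂ Mbar] [RiemannSurface Mbar]
    [CompactSpace Mbar] {n : ℕ} (x : X → EuclideanSpace ℝ (Fin n)) (E : Set Mbar) (π : X → Mbar) :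
    Prop where
  conformalImmersion : IsConformalImmersion x
  minimal : IsMinimal x
  complete : IsCompleteSurface x
  finite_punctures : E.Finite
  holomorphic : MDifferentiable 𝓘(ℂ) 𝓘(ℂ) π
  range_eq : Set.range π = Eᶜ
  covering : IsCoveringMapOn π Eᶜ
  forms : ∃ η : Fin n → (q : Mbar) → TangentSpace 𝓘(ℂ) q →L[ℂ] ℂ,
    (∀ i, IsHolomorphicFormOn (η i) Eᶜ) ∧ (∀ i, IsMeromorphicForm (η i)) ∧
      ∀ i p, weierstrassForm x i p = (η i (π p)).comp (mfderiv 𝓘(ℂ) 𝓘(ℂ) π p)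

/-- The hyperplane of the projective space defined by the linear form `L` (for `L ≠ 0`). -/
def hyperplane {n : ℕ} (L : Module.Dual ℂ (Fin n → ℂ)) : Set (Projectivization ℂ (Fin n → ℂ)) :=
  {P | L P.rep = 0}

/-- The image of `g` is contained in no hyperplane. -/
def LinearlyNondegenerate {X : Type*} {n : ℕ} (g : X → Projectivization ℂ (Fin n → ℂ)) : Prop :=
  ∀ L : Module.Dual ℂ (Fin n → ℂ), L ≠ 0 → ¬ Set.range g ⊆ hyperplane L

/-- Any `n` of the nonzero linear forms `L j` on `ℂⁿ` are linearly independent. -/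
def InGeneralPosition {n q : ℕ} (L : Fin q → Module.Dual ℂ (Fin n → ℂ)) : Prop :=
  (∀ j, L j ≠ 0) ∧
    ∀ μ : Fin n → Fin q, Function.Injective μ → LinearIndependent ℂ (fun i => L (μ i))

end MinimalSurface

end

open MinimalSurface

/-!
The surface is the real part of `F = (F₀, …, F₂ₘ)`, `n = 2m + 1`, with `dF i = f i dz` for rational
functions `f i` with at most simple poles at a set `A` of `n` points of the plane:
`f i = p i / ∏ a ∈ A, (z - a)`, where `(p i)` is an isotropic basis (`∑ i, p i ^ 2 = 0`) of the
polynomials of degree at most `2m`, that is, the rational normal curve placed in the quadric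
(`isotropicCurve`). The partial fractions of `f i` give `F i` as a combination of the functions
`log (z - a)`, which exist on the universal covering of `ℂ ∖ A` although they have periods in the
plane. Isotropy makes the surface conformal and minimal.

*Gauss map.* It is the curve `z ↦ (p i (z))` on `ℂ ∖ A`, so the linear forms on `ℂⁿ` correspond to
the polynomials of degree less than `n` (`restrictForm`), and a hyperplane is omitted if and only if
the polynomial has all its zeros in `A`. Hence `n (n + 1) / 2 = n (m + 1)` polynomials with zeros in
a set of `n = 2m + 1` points are needed of which any `n` are linearly independent. These are the
powers `X ^ k`, `k < n`, and for each of `m` pairs of points `a`, `b` the `n` products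
`(X - a) ^ k * (X - b) ^ (n - 1 - k)`; the pairs are chosen generically one after the other
(`exists_polynomials_anyIndependent`).

*Completeness.* As the `p i` span all polynomials of degree less than `n`, each `1 / (z - a)`,
`a ∈ A`, is a linear combination of the `f i`. So along a curve of finite length in the induced
metric `log (z - a)` has finite variation for every `a ∈ A`; its projection converges to a point
other than the points of `A` and `∞`, and the curve itself converges in the covering
(`IsWeierstrassData.isCompleteSurface`).

The universal covering is constructed as the space of homotopy classes of paths from a base point;
the compact surface is the Riemann sphere `OnePoint ℂ`, with the charts `z` and `1 / z`.
-/

noncomputable section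

/-! ### The universal covering -/

section UniversalCovering

/-- An open path-connected set `V` such that two paths inside `V` with the same end points are
homotopic in the ambient space. -/
structure IsRelSimplyConnected {B : Type*} [TopologicalSpace B] (V : Set B) : Prop where
  isOpen : IsOpen V
  isPathConnected : IsPathConnected V
  homotopic : ∀ ⦃x y : B⦄ (p q : Path x y), (∀ t, p t ∈ V) → (∀ t, q t ∈ V) → p.Homotopic q

/-- The relatively simply connected open sets form a basis of the topology. -/
class RelSimplyConnectedBasis (B : Type*) [TopologicalSpace B] : Prop where
  exists_subset : ∀ (x : B), ∀ U ∈ 𝓝 x, ∃ V : Set B, IsRelSimplyConnected V ∧ x ∈ V ∧ V ⊆ U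

variable {B : Type*} [TopologicalSpace B] {V V' : Set B} {x y z : B}

namespace IsRelSimplyConnected

/-- The class of the paths from `x` to `y` that stay in `V`. -/
def seg (hV : IsRelSimplyConnected V) (hx : x ∈ V) (hy : y ∈ V) : Path.Homotopic.Quotient x y :=
  .mk (hV.isPathConnected.joinedIn x hx y hy).somePath

theorem mk_eq_seg (hV : IsRelSimplyConnected V) (hx : x ∈ V) (hy : y ∈ V) (p : Path x y)
    (hp : ∀ t, p t ∈ V) : Path.Homotopic.Quotient.mk p = hV.seg hx hy :=
  Path.Homotopic.Quotient.eq.2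
    (hV.homotopic _ _ hp (hV.isPathConnected.joinedIn x hx y hy).somePath_mem)

theorem seg_eq_seg (hV : IsRelSimplyConnected V) (hV' : IsRelSimplyConnected V') (h : V' ⊆ V)
    (hx : x ∈ V') (hy : y ∈ V') : hV'.seg hx hy = hV.seg (h hx) (h hy) :=
  hV.mk_eq_seg _ _ _ fun t => h ((hV'.isPathConnected.joinedIn x hx y hy).somePath_mem t)

theorem seg_trans (hV : IsRelSimplyConnected V) (hx : x ∈ V) (hy : y ∈ V) (hz : z ∈ V) :
    (hV.seg hx hy).trans (hV.seg hy hz) = hV.seg hx hz := by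
  refine hV.mk_eq_seg hx hz (Path.trans _ _) fun t => ?_
  rw [Path.trans_apply]
  split_ifs
  · exact (hV.isPathConnected.joinedIn x hx y hy).somePath_mem _
  · exact (hV.isPathConnected.joinedIn y hy z hz).somePath_mem _

theorem seg_self (hV : IsRelSimplyConnected V) (hx : x ∈ V) : hV.seg hx hx = .refl x :=
  (hV.mk_eq_seg hx hx (Path.refl x) fun _ => hx).symm

end IsRelSimplyConnected

/-- The universal covering of a space with base point `x₀`: the homotopy classes of the paths that
start at `x₀`. -/
structure UniversalCovering (x₀ : B) where
  /-- The end point of the paths. -/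
  proj : B
  /-- The homotopy class. -/
  cls : Path.Homotopic.Quotient x₀ proj

namespace UniversalCovering

variable {x₀ : B}

/-- The sheet over `V` through the point `⟨x, c⟩`: the prolongations of `c` by a path in `V`. -/
def sheet (hV : IsRelSimplyConnected V) (hx : x ∈ V) (c : Path.Homotopic.Quotient x₀ x) :
    Set (UniversalCovering x₀) :=
  {e | ∃ h : e.1 ∈ V, e.2 = c.trans (hV.seg hx h)}

theorem sheet_subset (hV : IsRelSimplyConnected V) (hx : x ∈ V) (c : Path.Homotopic.Quotient x₀ x)
    (hV' : IsRelSimplyConnected V') (h : V' ⊆ V) {e : UniversalCovering x₀} (he : e ∈ sheet hV hx c)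
    (heV : e.1 ∈ V') : sheet hV' heV e.2 ⊆ sheet hV hx c := by
  rintro f ⟨hf, hf2⟩
  obtain ⟨h1, h2⟩ := he
  refine ⟨h hf, ?_⟩
  rw [hf2, h2, Path.Homotopic.Quotient.trans_assoc, hV.seg_eq_seg hV' h, hV.seg_trans]

theorem self_mem_sheet (hV : IsRelSimplyConnected V) {e : UniversalCovering x₀} (he : e.1 ∈ V) :
    e ∈ sheet hV he e.2 :=
  ⟨he, by rw [hV.seg_self, Path.Homotopic.Quotient.trans_refl]⟩

/-- The lift of `γ` that starts at `⟨x, c⟩`; at time `t` it is the class of `c` followed by the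
restriction of `γ` to `[0, t]`. -/
def lift (γ : Path x y) (c : Path.Homotopic.Quotient x₀ x) (t : unitInterval) :
    UniversalCovering x₀ :=
  ⟨γ t, c.trans ((Path.Homotopic.Quotient.mk (γ.subpath 0 t)).cast γ.source.symm rfl)⟩

theorem mk_subpath_trans (γ : Path x y) (s t : unitInterval) :
    ((Path.Homotopic.Quotient.mk (γ.subpath 0 s)).cast γ.source.symm rfl).trans
        (.mk (γ.subpath s t)) =
      (Path.Homotopic.Quotient.mk (γ.subpath 0 t)).cast γ.source.symm rfl := by
  have h : Path.Homotopic.Quotient.trans (.mk (γ.subpath 0 s)) (.mk (γ.subpath s t)) =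
      .mk (γ.subpath 0 t) :=
    Path.Homotopic.Quotient.eq.2 ⟨Path.Homotopy.subpathTransSubpath γ 0 s t⟩
  have key : ∀ {w v u : B} (hw : x = w) (p : Path.Homotopic.Quotient w v)
      (q : Path.Homotopic.Quotient v u), (p.cast hw rfl).trans q = (p.trans q).cast hw rfl := by
    rintro w v u rfl p q
    simp
  rw [key, h]

theorem lift_zero (γ : Path x y) (c : Path.Homotopic.Quotient x₀ x) :
    lift γ c 0 = ⟨x, c⟩ := by
  have key : ∀ {w : B} (hw : w = x), (⟨w, c.trans ((Path.Homotopic.Quotient.refl w).cast hw.symm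
      rfl)⟩ : UniversalCovering x₀) = ⟨x, c⟩ := by
    rintro w rfl
    simp
  rw [← key γ.source]
  simp [lift, Path.subpath_self]

theorem lift_one (γ : Path x y) (c : Path.Homotopic.Quotient x₀ x) :
    lift γ c 1 = ⟨y, c.trans (.mk γ)⟩ := by
  have key : ∀ {w : B} (hw : w = y), (⟨w, c.trans ((Path.Homotopic.Quotient.mk γ).cast rfl hw)⟩ :
      UniversalCovering x₀) = ⟨y, c.trans (.mk γ)⟩ := by
    rintro w rfl
    simp
  rw [← key γ.target]
  simp [lift, Path.subpath_zero_one]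

variable [RelSimplyConnectedBasis B]

/-- The topology with the sheets as basis. -/
instance : TopologicalSpace (UniversalCovering x₀) where
  IsOpen s := ∀ e ∈ s, ∃ (V : Set B) (hV : IsRelSimplyConnected V) (he : e.1 ∈ V),
    sheet hV he e.2 ⊆ s
  isOpen_univ e _ := by
    obtain ⟨V, hV, he, -⟩ := RelSimplyConnectedBasis.exists_subset e.1 Set.univ Filter.univ_mem
    exact ⟨V, hV, he, Set.subset_univ _⟩
  isOpen_inter s t hs ht e he := by
    obtain ⟨V, hV, heV, hVs⟩ := hs e he.1
    obtain ⟨W, hW, heW, hWt⟩ := ht e he.2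
    obtain ⟨U, hU, heU, hUVW⟩ := RelSimplyConnectedBasis.exists_subset e.1 (V ∩ W)
      (Filter.inter_mem (hV.isOpen.mem_nhds heV) (hW.isOpen.mem_nhds heW))
    refine ⟨U, hU, heU, Set.subset_inter ?_ ?_⟩
    · exact (sheet_subset hV heV e.2 hU (fun a h => (hUVW h).1) (self_mem_sheet hV heV) heU).trans
        hVs
    · exact (sheet_subset hW heW e.2 hU (fun a h => (hUVW h).2) (self_mem_sheet hW heW) heU).trans
        hWt
  isOpen_sUnion S hS e he := by
    obtain ⟨s, hs, hes⟩ := he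
    obtain ⟨V, hV, heV, h⟩ := hS s hs e hes
    exact ⟨V, hV, heV, h.trans (Set.subset_sUnion_of_mem hs)⟩

theorem isOpen_sheet (hV : IsRelSimplyConnected V) (hx : x ∈ V)
    (c : Path.Homotopic.Quotient x₀ x) : IsOpen (sheet hV hx c) :=
  fun _ he => ⟨V, hV, he.1, sheet_subset hV hx c hV subset_rfl he he.1⟩

theorem continuous_proj : Continuous (proj : UniversalCovering x₀ → B) := by
  refine ⟨fun U hU e he => ?_⟩
  obtain ⟨V, hV, heV, hVU⟩ := RelSimplyConnectedBasis.exists_subset e.1 U (hU.mem_nhds he)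
  exact ⟨V, hV, heV, fun f hf => hVU hf.1⟩

/-- Each sheet over `V` is the image of a continuous section. -/
theorem continuous_section (hV : IsRelSimplyConnected V) (hx : x ∈ V)
    (c : Path.Homotopic.Quotient x₀ x) :
    Continuous fun y : V => (⟨y, c.trans (hV.seg hx y.2)⟩ : UniversalCovering x₀) := by
  refine ⟨fun s hs => isOpen_iff_mem_nhds.2 fun y hy => ?_⟩
  obtain ⟨W, hW, hyW, hWs⟩ := hs _ hy
  obtain ⟨U, hU, hyU, hUVW⟩ := RelSimplyConnectedBasis.exists_subset y.1 (V ∩ W)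
    (Filter.inter_mem (hV.isOpen.mem_nhds y.2) (hW.isOpen.mem_nhds hyW))
  filter_upwards [(hU.isOpen.preimage continuous_subtype_val).mem_nhds hyU] with z hz
  refine hWs ⟨(hUVW hz).2, ?_⟩
  rw [Path.Homotopic.Quotient.trans_assoc, ← hW.seg_eq_seg hU (fun a h => (hUVW h).2) hyU hz,
    hV.seg_eq_seg hU (fun a h => (hUVW h).1) hyU hz, hV.seg_trans]

theorem isCoveringMap_proj : IsCoveringMap (proj : UniversalCovering x₀ → B) := by
  intro x
  obtain ⟨V, hV, hx, -⟩ := RelSimplyConnectedBasis.exists_subset x Set.univ Filter.univ_mem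
  let _ : TopologicalSpace (Path.Homotopic.Quotient x₀ x) := ⊥
  have : DiscreteTopology (Path.Homotopic.Quotient x₀ x) := ⟨rfl⟩
  have key : IsEvenlyCovered (proj : UniversalCovering x₀ → B) x
      (Path.Homotopic.Quotient x₀ x) := by
    refine ⟨inferInstance, V, hx, hV.isOpen, hV.isOpen.preimage continuous_proj, ?_, ?_⟩
    · exact
      { toFun := fun e => (⟨e.1.1, e.2⟩, e.1.2.trans (hV.seg e.2 hx))
        invFun := fun p => ⟨⟨p.1.1, p.2.trans (hV.seg hx p.1.2)⟩, p.1.2⟩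
        left_inv := by
          rintro ⟨⟨y, c⟩, hy⟩
          simp [Path.Homotopic.Quotient.trans_assoc, hV.seg_trans, hV.seg_self]
        right_inv := by
          rintro ⟨⟨y, hy⟩, c⟩
          simp [Path.Homotopic.Quotient.trans_assoc, hV.seg_trans, hV.seg_self]
        continuous_toFun := by
          refine Continuous.prodMk ((continuous_proj.comp continuous_subtype_val).subtype_mk _) ?_
          rw [continuous_discrete_rng]
          intro d
          convert (isOpen_sheet hV hx d).preimage continuous_subtype_val using 1
          ext ⟨⟨y, c⟩, hy⟩
          constructor
          · rintro rfl
            exact ⟨hy, by simp [Path.Homotopic.Quotient.trans_assoc, hV.seg_trans, hV.seg_self]⟩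
          · rintro ⟨h, h2⟩
            simp only at h2
            simp [h2, Path.Homotopic.Quotient.trans_assoc, hV.seg_trans, hV.seg_self]
        continuous_invFun := by
          refine Continuous.subtype_mk ?_ _
          rw [continuous_prod_of_discrete_right]
          exact fun d => continuous_section hV hx d }
    · intro e
      rfl
  exact key.to_isEvenlyCovered_preimage

theorem continuous_lift (γ : Path x y) (c : Path.Homotopic.Quotient x₀ x) :
    Continuous (lift γ c) := by
  refine ⟨fun s hs => isOpen_iff_mem_nhds.2 fun t₀ ht₀ => ?_⟩
  obtain ⟨V, hV, htV, hVs⟩ := hs _ ht₀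
  obtain ⟨J, ⟨hJ, hJc⟩, hJV⟩ := (LocallyConvexSpace.convex_basis (𝕜 := ℝ) (t₀ : ℝ)).comap
    (Subtype.val : unitInterval → ℝ) |>.mem_iff (t := γ ⁻¹' V) |>.1 (by
      rw [← nhds_induced]
      exact γ.continuous.continuousAt.preimage_mem_nhds (hV.isOpen.mem_nhds htV))
  have hJ' : Subtype.val ⁻¹' J ∈ 𝓝 t₀ := continuous_subtype_val.continuousAt.preimage_mem_nhds hJ
  filter_upwards [hJ'] with t ht
  refine hVs ⟨(hJV ht : γ t ∈ V), ?_⟩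
  have htV' : γ t ∈ V := hJV ht
  have hseg : Path.Homotopic.Quotient.mk (γ.subpath t₀ t) = hV.seg htV htV' := by
    refine hV.mk_eq_seg _ _ _ fun r => ?_
    have hr : γ.subpath t₀ t r ∈ Set.range (γ.subpath t₀ t) := ⟨r, rfl⟩
    rw [Path.range_subpath] at hr
    obtain ⟨u, hu, hur⟩ := hr
    rw [← hur]
    apply hJV
    have := hJc.ordConnected.uIcc_subset (mem_of_mem_nhds hJ) ht
    apply this
    rw [Set.mem_uIcc] at hu ⊢
    exact hu
  change _ = (lift γ c t₀).cls.trans (hV.seg htV htV')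
  rw [← hseg]
  simp only [lift]
  rw [Path.Homotopic.Quotient.trans_assoc, mk_subpath_trans]

theorem joined_base (e : UniversalCovering x₀) :
    Joined (⟨x₀, .refl x₀⟩ : UniversalCovering x₀) e := by
  obtain ⟨y, c⟩ := e
  induction c with | mk γ =>
  refine ⟨⟨⟨lift γ (.refl x₀), continuous_lift _ _⟩, lift_zero _ _, ?_⟩⟩
  have := lift_one γ (.refl x₀)
  rw [Path.Homotopic.Quotient.refl_trans] at this
  exact this

instance : PathConnectedSpace (UniversalCovering x₀) where
  nonempty := ⟨⟨x₀, .refl x₀⟩⟩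
  joined e f := (joined_base e).symm.trans (joined_base f)

/-- A loop upstairs is the lift of its projection `γ`; as this lift starts at `⟨x, c⟩` and ends at
`⟨x, c * [γ]⟩`, the class of `γ` is trivial. -/
instance : SimplyConnectedSpace (UniversalCovering x₀) := by
  rw [simply_connected_iff_loops_nullhomotopic]
  refine ⟨inferInstance, ?_⟩
  rintro ⟨x, c⟩ Γ
  rw [← Path.Homotopic.Quotient.eq]
  apply isCoveringMap_proj.injective_path_homotopic_map
  let γ : Path x x := Γ.map continuous_proj
  have h : ⇑Γ = lift γ c := isCoveringMap_proj.eq_of_comp_eq Γ.continuous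
    (continuous_lift γ c) rfl 0 (Γ.source.trans (lift_zero γ c).symm)
  have h1 : lift γ c 1 = ⟨x, c⟩ := by
    rw [← Γ.target]
    exact (congrFun h 1).symm
  rw [lift_one] at h1
  have h2 : c.trans (.mk γ) = c := eq_of_heq (UniversalCovering.mk.inj h1).2
  have h3 : Path.Homotopic.Quotient.mk γ = .refl x := by
    have := congrArg (Path.Homotopic.Quotient.trans c.symm) h2
    rwa [← Path.Homotopic.Quotient.trans_assoc, Path.Homotopic.Quotient.symm_trans,
      Path.Homotopic.Quotient.refl_trans] at this
  exact h3

end UniversalCovering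

end UniversalCovering

/-! ### Products of powers of two generic linear forms -/

section GeneralPosition

open Polynomial

/-- A nonzero polynomial with at most `s` monomials does not vanish to the order `s` at `1`. -/
theorem Polynomial.eq_zero_of_card_support_le_of_X_sub_one_pow_dvd (s : ℕ) (p : ℂ[X])
    (hs : p.support.card ≤ s) (hp : (X - C 1) ^ s ∣ p) : p = 0 := by
  induction s generalizing p with
  | zero => simpa using hs
  | succ s ih =>
    by_contra hne
    set k := p.natDegree with hk
    -- The Euler operator `X d/dX - k` kills the leading monomial.
    have hcoeff : ∀ j : ℕ,
        (X * derivative p - C (k : ℂ) * p).coeff j = ((j : ℂ) - k) * p.coeff j := by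
      intro j
      rw [coeff_sub, coeff_C_mul, sub_mul]
      congr 1
      cases j with
      | zero => simp
      | succ j =>
        rw [coeff_X_mul, coeff_derivative]
        push_cast
        ring
    have hq : X * derivative p - C (k : ℂ) * p = 0 := by
      apply ih
      · have hsub : (X * derivative p - C (k : ℂ) * p).support ⊆ p.support.erase k := by
          intro j hj
          rw [mem_support_iff, hcoeff] at hj
          rw [Finset.mem_erase, mem_support_iff]
          refine ⟨?_, right_ne_zero_of_mul hj⟩
          rintro rfl
          simp at hj
        refine (Finset.card_le_card hsub).trans ?_
        rw [Finset.card_erase_of_mem (natDegree_mem_support_of_nonzero hne)]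
        omega
      · have h1 := pow_sub_one_dvd_derivative_of_pow_dvd hp
        rw [Nat.add_sub_cancel] at h1
        have h2 : (X - C (1 : ℂ)) ^ s ∣ p := (pow_dvd_pow _ s.le_succ).trans hp
        exact dvd_sub (h1.mul_left _) (h2.mul_left _)
    have hmono : p = monomial k (p.coeff k) := by
      ext j
      rw [coeff_monomial]
      split_ifs with h
      · rw [h]
      · have := hcoeff j
        rw [hq, coeff_zero, eq_comm, mul_eq_zero, sub_eq_zero] at this
        exact this.resolve_left fun h' => h (by exact_mod_cast h'.symm)
    have hroot : p.eval 1 = 0 := by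
      have : X - C 1 ∣ p := (dvd_pow_self _ s.succ_ne_zero).trans hp
      exact dvd_iff_isRoot.1 this
    rw [hmono, eval_monomial] at hroot
    exact hne (leadingCoeff_eq_zero.1 (show p.coeff k = 0 by simpa using hroot))

/-- In a space of polynomials of dimension at most `r`, only at finitely many points some nonzero
element vanishes to the order `r`. -/
theorem Submodule.finite_setOf_exists_X_sub_C_pow_dvd (r : ℕ) (W : Submodule ℂ ℂ[X])
    [FiniteDimensional ℂ W] (hW : Module.finrank ℂ W ≤ r) :
    {a : ℂ | ∃ w ∈ W, w ≠ 0 ∧ (X - C a) ^ r ∣ w}.Finite := by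
  induction r generalizing W with
  | zero =>
    have : W = ⊥ := Submodule.finrank_eq_zero.1 (Nat.le_zero.1 hW)
    subst this
    convert Set.finite_empty (α := ℂ)
    ext a
    simp
  | succ r ih =>
    by_cases hbot : W = ⊥
    · subst hbot
      convert Set.finite_empty (α := ℂ)
      ext a
      simp
    obtain ⟨w₁, hw₁, hne⟩ := Submodule.exists_mem_ne_zero_of_ne_bot hbot
    -- The Wronskian with `w₁` lowers the dimension by one and orders of vanishing by one.
    let φ : ℂ[X] →ₗ[ℂ] ℂ[X] := wronskianBilin ℂ w₁
    have hφ : ∀ w, φ w = w₁ * derivative w - derivative w₁ * w := fun w => rfl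
    have hrank : Module.finrank ℂ (W.map φ) ≤ r := by
      have h1 := LinearMap.finrank_range_add_finrank_ker (φ.domRestrict W)
      have h2 : LinearMap.range (φ.domRestrict W) = W.map φ := LinearMap.range_domRestrict _ _
      rw [h2] at h1
      have h3 : 0 < Module.finrank ℂ (LinearMap.ker (φ.domRestrict W)) := by
        refine Submodule.one_le_finrank_iff.2 fun h => hne ?_
        have h4 : (⟨w₁, hw₁⟩ : W) ∈ LinearMap.ker (φ.domRestrict W) := by
          rw [LinearMap.mem_ker, LinearMap.domRestrict_apply, hφ]
          ring
        rw [h, Submodule.mem_bot] at h4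
        exact congrArg Subtype.val h4
      omega
    refine ((ih (W.map φ) hrank).union (rootSet_finite w₁ ℂ)).subset ?_
    rintro a ⟨w, hw, hw0, hdvd⟩
    by_contra hcon
    rw [Set.mem_union, not_or] at hcon
    obtain ⟨h1, h2⟩ := hcon
    have hroot : ¬ w₁.IsRoot a := fun h => h2 (by
      rw [mem_rootSet]
      exact ⟨hne, by simpa using h⟩)
    have hzero : φ w = 0 := by
      by_contra h
      refine h1 ⟨φ w, Submodule.mem_map_of_mem hw, h, ?_⟩
      rw [hφ]
      exact dvd_sub (Dvd.dvd.mul_left (pow_sub_one_dvd_derivative_of_pow_dvd hdvd) _)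
        (Dvd.dvd.mul_left ((pow_dvd_pow _ r.le_succ).trans hdvd) _)
    have hwa : w.IsRoot a := dvd_iff_isRoot.1 ((dvd_pow_self _ r.succ_ne_zero).trans hdvd)
    have hder : derivative w ≠ 0 := by
      intro h
      obtain ⟨c, rfl⟩ := natDegree_eq_zero.1 (derivative_eq_zero.1 h)
      simp_all
    have hmult := derivative_rootMultiplicity_of_root hwa
    have hpos : 0 < w.rootMultiplicity a := (rootMultiplicity_pos hw0).2 hwa
    have hdvd' : (X - C a) ^ w.rootMultiplicity a ∣ derivative w := by
      have h3 : (X - C a) ^ w.rootMultiplicity a ∣ w₁ * derivative w := by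
        rw [hφ, sub_eq_zero] at hzero
        rw [hzero]
        exact Dvd.dvd.mul_left (pow_rootMultiplicity_dvd w a) _
      refine IsCoprime.dvd_of_dvd_mul_left (IsCoprime.pow_left ?_) h3
      exact (irreducible_X_sub_C a).coprime_iff_not_dvd.2 fun h => hroot (dvd_iff_isRoot.1 h)
    have := (le_rootMultiplicity_iff hder).2 hdvd'
    omega

/-- The form `(X - a)^k (X - b)^(n-1-k)`, one of the `n` monomials in `X - a` and `X - b`. -/
def pairMonomial (n : ℕ) (a b : ℂ) (k : Fin n) : ℂ[X] :=
  (X - C a) ^ (k : ℕ) * (X - C b) ^ (n - 1 - k)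

theorem pairMonomial_mem_degreeLT (n : ℕ) (a b : ℂ) (k : Fin n) :
    pairMonomial n a b k ∈ degreeLT ℂ n := by
  rw [mem_degreeLT]
  refine (degree_mul_le _ _).trans_lt ?_
  rw [degree_pow, degree_pow, degree_X_sub_C, degree_X_sub_C]
  simp only [nsmul_one]
  have := k.2
  norm_cast
  omega

theorem eval_pairMonomial (n : ℕ) (a b : ℂ) (k : Fin n) (z : ℂ) :
    (pairMonomial n a b k).eval z = (z - a) ^ (k : ℕ) * (z - b) ^ (n - 1 - k) := by
  simp [pairMonomial]

/-- The involution `u ↦ u / (u - 1)` exchanges the monomials `X^k` and `X^k (X - 1)^(n-1-k)`. -/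
theorem sum_coeff_smul_pairMonomial {n : ℕ} (c : Fin n → ℂ) :
    ∑ i : Fin n, (∑ k, c k • pairMonomial n 0 1 k).coeff i • pairMonomial n 0 1 i =
      ∑ k : Fin n, c k • (X : ℂ[X]) ^ (k : ℕ) := by
  set q := ∑ k, c k • pairMonomial n 0 1 k with hq
  have hqn : q ∈ degreeLT ℂ n :=
    Submodule.sum_mem _ fun k _ => Submodule.smul_mem _ _ (pairMonomial_mem_degreeLT n 0 1 k)
  refine eq_of_infinite_eval_eq _ _ ((Set.finite_singleton (1 : ℂ)).infinite_compl.mono ?_)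
  intro u hu
  have hu' : u - 1 ≠ 0 := sub_ne_zero.2 hu
  have key : ∀ k : Fin n, (u - 1) ^ (n - 1) * (u / (u - 1)) ^ (k : ℕ) =
      u ^ (k : ℕ) * (u - 1) ^ (n - 1 - k) := by
    intro k
    have hk := k.2
    rw [div_pow, show n - 1 = (n - 1 - k) + k by omega, pow_add]
    simp only [Nat.add_sub_cancel]
    field_simp
  have h1 : q.eval (u / (u - 1)) = ∑ i : Fin n, q.coeff i * (u / (u - 1)) ^ (i : ℕ) := by
    exact eval_eq_sum_degreeLTEquiv hqn _
  have h2 : q.eval (u / (u - 1)) = ∑ k, c k * ((u / (u - 1)) ^ (k : ℕ) *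
      (u / (u - 1) - 1) ^ (n - 1 - k)) := by
    simp [hq, eval_finsetSum, eval_pairMonomial]
  have h3 : ∀ k : Fin n, (u - 1) ^ (n - 1) * ((u / (u - 1)) ^ (k : ℕ) *
      (u / (u - 1) - 1) ^ (n - 1 - k)) = u ^ (k : ℕ) := by
    intro k
    rw [← mul_assoc, key, div_sub_one hu', mul_assoc, ← mul_pow]
    simp [hu']
  have h4 := congrArg (fun x => (u - 1) ^ (n - 1) * x) (h1.symm.trans h2)
  simp only [Finset.mul_sum] at h4
  simp only [Set.mem_ofPred_eq, eval_finsetSum, eval_smul, eval_pairMonomial, smul_eq_mul, eval_pow,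
    eval_X, sub_zero]
  calc _ = _ := Finset.sum_congr rfl fun i _ => by rw [← key]; ring
    _ = _ := h4
    _ = _ := Finset.sum_congr rfl fun k _ => by rw [mul_left_comm, h3]

theorem coeff_pairMonomial_mul_pow {n : ℕ} (t : ℂ) (k : Fin n) (i : ℕ) :
    (pairMonomial n 0 t k).coeff i * t ^ i = t ^ (n - 1) * (pairMonomial n 0 1 k).coeff i := by
  rw [← comp_C_mul_X_coeff, ← coeff_C_mul]
  congr 1
  have hk : n - 1 = k + (n - 1 - k) := by omega
  simp only [pairMonomial, mul_comp, pow_comp, sub_comp, X_comp, C_comp, map_zero, sub_zero,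
    map_one, C_pow]
  nth_rewrite 2 [hk]
  rw [pow_add, mul_pow, ← mul_pow]
  have : C t * X - C t = C t * (X - 1 : ℂ[X]) := by ring
  rw [this, mul_pow (C t) (X - 1)]
  ring

/-- A combination of at most `n - r` of the polynomials `X^k (X - 1)^(n-1-k)` has degree at least
`r`, unless it is zero. -/
theorem eq_zero_of_coeff_sum_pairMonomial {n r : ℕ} (S : Finset (Fin n)) (hS : r + S.card ≤ n)
    (c : Fin n → ℂ) (hc : ∀ k ∉ S, c k = 0)
    (h : ∀ i, r ≤ i → i < n → (∑ k, c k • pairMonomial n 0 1 k).coeff i = 0) : c = 0 := by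
  have h0 : ∑ k : Fin n, c k • (X : ℂ[X]) ^ (k : ℕ) = 0 := by
    apply eq_zero_of_card_support_le_of_X_sub_one_pow_dvd (n - r)
    · have hsub : (∑ k : Fin n, c k • (X : ℂ[X]) ^ (k : ℕ)).support ⊆ S.image Fin.val := by
        intro j hj
        rw [mem_support_iff, finsetSum_coeff] at hj
        obtain ⟨k, -, hk⟩ := Finset.exists_ne_zero_of_sum_ne_zero hj
        rw [coeff_smul, coeff_X_pow, smul_eq_mul, mul_ite, mul_one, mul_zero] at hk
        split_ifs at hk with hjk
        · exact Finset.mem_image.2 ⟨k, by_contra fun hkS => hk (hc k hkS), hjk.symm⟩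
        · exact absurd rfl hk
      have := (Finset.card_le_card hsub).trans Finset.card_image_le
      omega
    · rw [← sum_coeff_smul_pairMonomial]
      refine Finset.dvd_sum fun i _ => ?_
      by_cases hi : r ≤ i
      · rw [h i hi i.2, zero_smul]
        exact dvd_zero _
      · exact dvd_smul_of_dvd _ (((pow_dvd_pow _ (by omega)).mul_left _))
  funext k
  have := congrArg (fun p => coeff p k) h0
  simpa [finsetSum_coeff, coeff_X_pow, Fin.val_inj] using this

/-- If no nonzero element of `W` vanishes to the order `r` at `0` and `r + |S| ≤ n`, then for `t`
close to `0` no nonzero combination of the forms `X^k (X - t)^(n-1-k)`, `k ∈ S`, lies in `W`. The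
substitution of `t X` for `X` turns `t` into `1` and `W` into a space that converges, for `t → 0`,
to one of polynomials of degree less than `r`; in the limit the claim is
`eq_zero_of_coeff_sum_pairMonomial`, and linear independence is an open condition. -/
theorem eventually_eq_zero_of_sum_pairMonomial_mem_zero {n r : ℕ} (W : Submodule ℂ ℂ[X])
    (hW : ∀ w ∈ W, X ^ r ∣ w → w = 0) (S : Finset (Fin n)) (hS : r + S.card ≤ n) :
    ∀ᶠ t in 𝓝[≠] (0 : ℂ), ∀ c : Fin n → ℂ, (∀ k ∉ S, c k = 0) →
      ∑ k, c k • pairMonomial n 0 t k ∈ W → c = 0 := by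
  -- On `W`, every coefficient is a linear function of the coefficients of order less than `r`.
  obtain ⟨μ, hμ⟩ : ∃ μ : ℕ → Fin r → ℂ, ∀ w ∈ W, ∀ i, w.coeff i = ∑ j, μ i j * w.coeff j := by
    let ρ : W →ₗ[ℂ] (Fin r → ℂ) := LinearMap.pi fun j => (lcoeff ℂ (j : ℕ)).comp W.subtype
    have hρ : ∀ w j, ρ w j = (w : ℂ[X]).coeff j := fun w j => rfl
    obtain ⟨g, hg⟩ := ρ.exists_leftInverse_of_injective (LinearMap.ker_eq_bot'.2 (by
      intro w hw
      apply Subtype.ext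
      refine hW w w.2 (X_pow_dvd_iff.2 fun d hd => ?_)
      rw [← hρ w ⟨d, hd⟩, hw]
      rfl))
    refine ⟨fun i j => (lcoeff ℂ i) (g fun j' => if j = j' then 1 else 0), fun w hw i => ?_⟩
    have h1 : g (ρ ⟨w, hw⟩) = ⟨w, hw⟩ := LinearMap.congr_fun hg _
    have h2 := LinearMap.pi_apply_eq_sum_univ ((lcoeff ℂ i).comp (W.subtype.comp g)) (ρ ⟨w, hw⟩)
    rw [LinearMap.comp_apply, LinearMap.comp_apply, h1] at h2
    refine h2.trans (Finset.sum_congr rfl fun j _ => ?_)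
    rw [smul_eq_mul, mul_comm, hρ]
    rfl
  let E : Fin n → ℂ[X] := pairMonomial n 0 1
  -- `∑ k, d k • v t k = 0` says that `∑ k, d k • E k` satisfies the equations of the rescaled `W`.
  let v : ℂ → S → (Fin (n - r) → ℂ) := fun t k i =>
    (E k).coeff (r + i) - ∑ j : Fin r, μ (r + i) j * t ^ (r + i - j : ℕ) * (E k).coeff j
  have hv : Continuous v := by fun_prop
  have hv0 : LinearIndependent ℂ (v 0) := by
    rw [Fintype.linearIndependent_iff]
    intro d hd k
    have hz : (fun k => if hk : k ∈ S then d ⟨k, hk⟩ else 0 : Fin n → ℂ) = 0 := by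
      refine eq_zero_of_coeff_sum_pairMonomial S hS _ (fun k hk => dif_neg hk) fun i hi hin => ?_
      have h1 := congrFun hd ⟨i - r, by omega⟩
      simp only [Finset.sum_apply, Pi.smul_apply, Pi.zero_apply, smul_eq_mul, v] at h1
      rw [finsetSum_coeff, ← Finset.sum_subset (Finset.subset_univ S)
        (fun k _ hk => by simp [hk]), ← Finset.sum_coe_sort S]
      refine Eq.trans ?_ h1
      refine Finset.sum_congr rfl fun k _ => ?_
      have h2 : ∑ j : Fin r, μ (r + (i - r)) j * 0 ^ (r + (i - r) - j : ℕ) * (E k).coeff j = 0 := by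
        refine Finset.sum_eq_zero fun j _ => ?_
        have hj := j.2
        rw [zero_pow (by omega), mul_zero, zero_mul]
      rw [h2, dif_pos k.2, sub_zero, coeff_smul, smul_eq_mul, Nat.add_sub_cancel' hi]
    simpa using congrFun hz k
  have hev := (hv.tendsto 0).eventually hv0.eventually
  filter_upwards [hev.filter_mono nhdsWithin_le_nhds, self_mem_nhdsWithin] with t ht ht0 c hc hmem
  replace ht0 : t ≠ 0 := ht0
  set p := ∑ k, c k • pairMonomial n 0 t k with hp
  set q := ∑ k, c k • E k with hq
  have hpq : ∀ i, p.coeff i * t ^ i = t ^ (n - 1) * q.coeff i := by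
    intro i
    rw [hp, hq, finsetSum_coeff, finsetSum_coeff, Finset.sum_mul, Finset.mul_sum]
    refine Finset.sum_congr rfl fun k _ => ?_
    rw [coeff_smul, coeff_smul, smul_eq_mul, smul_eq_mul, mul_assoc, coeff_pairMonomial_mul_pow]
    ring
  have hqμ : ∀ i : Fin (n - r), q.coeff (r + i) =
      ∑ j : Fin r, μ (r + i) j * t ^ (r + i - j : ℕ) * q.coeff j := by
    intro i
    apply mul_left_cancel₀ (pow_ne_zero (n - 1) ht0)
    rw [← hpq, hμ p hmem, Finset.sum_mul, Finset.mul_sum]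
    refine Finset.sum_congr rfl fun j _ => ?_
    have hj : r + (i : ℕ) = (r + i - j) + j := by omega
    nth_rewrite 2 [hj]
    rw [pow_add]
    linear_combination (μ (r + i) j * t ^ (r + i - j : ℕ)) * hpq j
  have hzero : ∑ k : S, c k • v t k = 0 := by
    funext i
    simp only [Finset.sum_apply, Pi.smul_apply, Pi.zero_apply, smul_eq_mul, v]
    have h1 : ∀ i, q.coeff i = ∑ k : S, c k * (E k).coeff i := by
      intro i
      rw [hq, finsetSum_coeff, ← Finset.sum_subset (Finset.subset_univ S)
        (fun k _ hk => by simp [hc k hk]), ← Finset.sum_coe_sort S]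
      simp
    have h2 := hqμ i
    simp only [h1] at h2
    simp only [mul_sub, Finset.sum_sub_distrib, h2, Finset.mul_sum]
    rw [Finset.sum_comm, sub_eq_zero]
    exact Finset.sum_congr rfl fun k _ => Finset.sum_congr rfl fun j _ => by ring
  have := Fintype.linearIndependent_iff.1 ht (fun k => c k) hzero
  funext k
  by_cases hk : k ∈ S
  · exact this ⟨k, hk⟩
  · exact hc k hk

/-- The case of a general point `a`, by translation. -/
theorem eventually_eq_zero_of_sum_pairMonomial_mem {n r : ℕ} (W : Submodule ℂ ℂ[X]) (a : ℂ)
    (hW : ∀ w ∈ W, (X - C a) ^ r ∣ w → w = 0) (S : Finset (Fin n)) (hS : r + S.card ≤ n) :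
    ∀ᶠ b in 𝓝[≠] a, ∀ c : Fin n → ℂ, (∀ k ∉ S, c k = 0) →
      ∑ k, c k • pairMonomial n a b k ∈ W → c = 0 := by
  have htay : ∀ b k, taylor a (pairMonomial n a b k) = pairMonomial n 0 (b - a) k := by
    intro b k
    simp only [pairMonomial, taylor_mul, taylor_pow, map_sub, taylor_X, taylor_C, map_zero]
    ring
  have h := eventually_eq_zero_of_sum_pairMonomial_mem_zero (W.map (taylor a)) (r := r) (by
    rintro _ ⟨w, hw, rfl⟩ hdvd
    rw [hW w hw, map_zero]
    obtain ⟨u, hu⟩ := hdvd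
    refine ⟨taylor (-a) u, taylor_injective a ?_⟩
    rw [hu, taylor_mul, taylor_pow, taylor_taylor]
    simp) S hS
  have ht : Filter.Tendsto (fun b => b - a) (𝓝[≠] a) (𝓝[≠] 0) := by
    refine tendsto_nhdsWithin_iff.2 ⟨?_, ?_⟩
    · have : Filter.Tendsto (fun b => b - a) (𝓝 a) (𝓝 (a - a)) :=
        Filter.tendsto_id.sub_const a
      rw [sub_self] at this
      exact this.mono_left nhdsWithin_le_nhds
    · filter_upwards [self_mem_nhdsWithin] with b hb
      exact sub_ne_zero.2 hb
  filter_upwards [ht.eventually h] with b hb c hc hmem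
  refine hb c hc ⟨_, hmem, ?_⟩
  simp only [map_sum, map_smul, htay]

/-- Any `n` members of the family `v` are linearly independent. -/
def AnyIndependent {ι : Type*} (n : ℕ) (v : ι → ℂ[X]) : Prop :=
  ∀ T : Finset ι, T.card ≤ n → LinearIndepOn ℂ v T

/-- A generic pair of points `a`, `b` is good for finitely many subspaces at the same time. -/
theorem exists_pair_forall_eq_zero_of_sum_mem {κ : Type*} [Finite κ] {n : ℕ}
    (W : κ → Submodule ℂ ℂ[X]) (r : κ → ℕ) (hfin : ∀ T, FiniteDimensional ℂ (W T))
    (hrank : ∀ T, Module.finrank ℂ (W T) ≤ r T) (A : Finset ℂ) :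
    ∃ a b, a ∉ A ∧ b ∉ A ∧ a ≠ b ∧ ∀ (T : κ) (S : Finset (Fin n)), r T + S.card ≤ n →
      ∀ c : Fin n → ℂ, (∀ k ∉ S, c k = 0) → ∑ k, c k • pairMonomial n a b k ∈ W T → c = 0 := by
  obtain ⟨a, ha⟩ : ∃ a, a ∉ (A : Set ℂ) ∪ ⋃ T : κ,
      {a : ℂ | ∃ w ∈ W T, w ≠ 0 ∧ (X - C a) ^ r T ∣ w} :=
    (A.finite_toSet.union (Set.finite_iUnion fun T =>
      Submodule.finite_setOf_exists_X_sub_C_pow_dvd (r T) (W T) (hrank T))).exists_notMem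
  rw [Set.mem_union, Set.mem_iUnion, not_or, not_exists] at ha
  have hgood : ∀ᶠ b in 𝓝[≠] a, ∀ (T : κ) (S : Finset (Fin n)), r T + S.card ≤ n →
      ∀ c : Fin n → ℂ, (∀ k ∉ S, c k = 0) → ∑ k, c k • pairMonomial n a b k ∈ W T → c = 0 := by
    rw [Filter.eventually_all]
    intro T
    rw [Filter.eventually_all]
    intro S
    by_cases hTS : r T + S.card ≤ n
    · filter_upwards [eventually_eq_zero_of_sum_pairMonomial_mem (W T) a (fun w hw hdvd =>
        by_contra fun h0 => ha.2 T ⟨w, hw, h0, hdvd⟩) S hTS] with b hb _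
      exact hb
    · exact Filter.Eventually.of_forall fun b h => absurd h hTS
  have hA : ∀ᶠ b in 𝓝[≠] a, b ∉ A :=
    nhdsWithin_le_nhds (A.finite_toSet.isClosed.isOpen_compl.mem_nhds ha.1)
  obtain ⟨b, hb, hbA, hba⟩ := (hgood.and (hA.and self_mem_nhdsWithin)).exists
  exact ⟨a, b, ha.1, hbA, Ne.symm hba, hb⟩

/-- A generic pair `a`, `b` is good for all spans of subfamilies of `v`, so its `n` forms can be
added to the family. -/
theorem exists_anyIndependent_sumElim {ι : Type} [Fintype ι] {n : ℕ} {v : ι → ℂ[X]}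
    (hv : AnyIndependent n v) (A : Finset ℂ) :
    ∃ a b, a ∉ A ∧ b ∉ A ∧ a ≠ b ∧ AnyIndependent n (Sum.elim v (pairMonomial n a b)) := by
  classical
  have hfin : ∀ T : Finset ι, FiniteDimensional ℂ (Submodule.span ℂ (v '' T)) := fun T =>
    FiniteDimensional.span_of_finite ℂ (T.finite_toSet.image v)
  have hrank : ∀ T : Finset ι, Module.finrank ℂ (Submodule.span ℂ (v '' T)) ≤ T.card := by
    intro T
    have := finrank_span_finset_le_card (R := ℂ) (T.image v)
    rw [Finset.coe_image] at this
    exact this.trans Finset.card_image_le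
  obtain ⟨a, b, ha, hb, hab, h⟩ := exists_pair_forall_eq_zero_of_sum_mem (n := n) _ _ hfin hrank A
  refine ⟨a, b, ha, hb, hab, fun R hR => ?_⟩
  rw [linearIndepOn_finset_iff]
  intro f hf
  rw [← Finset.toLeft_disjSum_toRight (u := R)] at hf
  rw [← Finset.card_toLeft_add_card_toRight] at hR
  rw [Finset.sum_disjSum] at hf
  simp only [Sum.elim_inl, Sum.elim_inr] at hf
  have hmem : ∑ i ∈ R.toLeft, f (.inl i) • v i ∈ Submodule.span ℂ (v '' R.toLeft) :=
    Submodule.sum_mem _ fun i hi =>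
      Submodule.smul_mem _ _ (Submodule.subset_span ⟨i, hi, rfl⟩)
  have hc := h R.toLeft R.toRight hR (fun k => if k ∈ R.toRight then f (.inr k) else 0)
    (fun k hk => if_neg hk) (by
      simp only [ite_smul, zero_smul, Finset.sum_ite_mem, Finset.univ_inter]
      rw [← neg_eq_of_add_eq_zero_right hf]
      exact neg_mem hmem)
  have hr : ∀ k ∈ R.toRight, f (.inr k) = 0 := fun k hk => by simpa [hk] using congrFun hc k
  rw [Finset.sum_eq_zero (s := R.toRight) (fun k hk => by rw [hr k hk, zero_smul]), add_zero] at hf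
  have hl := linearIndepOn_finset_iff.1 (hv R.toLeft (by omega)) (fun i => f (.inl i)) hf
  rintro (i | k) hi
  · exact hl i (Finset.mem_toLeft.2 hi)
  · exact hr k (Finset.mem_toRight.2 hi)

/-- The pair `0`, `∞` (with the forms `X ^ k`) and `m` generic pairs of points of the plane give
`n * (m + 1)` polynomials of degree less than `n` in general position whose zeros belong to a set
`A` of `2 * m + 1` points. -/
theorem exists_polynomials_anyIndependent (n m : ℕ) :
    ∃ (ι : Type) (_ : Fintype ι) (v : ι → ℂ[X]) (A : Finset ℂ), Fintype.card ι = n * (m + 1) ∧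
      A.card = 2 * m + 1 ∧ (∀ i, v i ∈ degreeLT ℂ n) ∧ (∀ i, ∀ z ∉ A, (v i).eval z ≠ 0) ∧
      AnyIndependent n v := by
  induction m with
  | zero =>
    refine ⟨Fin n, inferInstance, fun k => X ^ (k : ℕ), {0}, by simp, by simp, ?_, ?_, ?_⟩
    · intro k
      rw [mem_degreeLT, degree_X_pow]
      exact_mod_cast k.2
    · intro k z hz
      have hz' : z ≠ 0 := by simpa using hz
      simp [hz']
    · intro T _
      refine LinearIndependent.linearIndepOn ?_ _
      rw [Fintype.linearIndependent_iff]
      intro c hc k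
      have := congrArg (fun p => coeff p k) hc
      simpa [finsetSum_coeff, coeff_X_pow, Fin.val_inj] using this
  | succ m ih =>
    obtain ⟨ι, hι, v, A, hcard, hA, hdeg, hroots, hv⟩ := ih
    obtain ⟨a, b, ha, hb, hab, hgp⟩ := exists_anyIndependent_sumElim hv A
    refine ⟨ι ⊕ Fin n, inferInstance, Sum.elim v (pairMonomial n a b), insert a (insert b A), ?_,
      ?_, ?_, ?_, hgp⟩
    · rw [Fintype.card_sum, hcard, Fintype.card_fin]
      ring
    · rw [Finset.card_insert_of_notMem (by simp [ha, hab]), Finset.card_insert_of_notMem hb, hA]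
      ring
    · rintro (i | k)
      · exact hdeg i
      · exact pairMonomial_mem_degreeLT n a b k
    · rintro (i | k) z hz
      · exact hroots i z (by simp_all)
      · simp only [Finset.mem_insert, not_or] at hz
        rw [Sum.elim_inr, eval_pairMonomial]
        exact mul_ne_zero (pow_ne_zero _ (sub_ne_zero.2 hz.1))
          (pow_ne_zero _ (sub_ne_zero.2 hz.2.1))

end GeneralPosition

/-! ### The rational normal curve in the quadric -/

section IsotropicCurve

open Polynomial

/-- The rational normal curve of degree `2m`, in coordinates in which it lies in the quadric
`∑ i, z i ^ 2 = 0`: for `i < m` the coordinates `i` and `2m - i` have squares that add up to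
`4 * X ^ (2 * m)`, and the factor of the middle coordinate makes its square cancel these `m`
sums. -/
def isotropicCurve (m : ℕ) (i : Fin (2 * m + 1)) : ℂ[X] :=
  if (i : ℕ) < m then X ^ (i : ℕ) + X ^ (2 * m - i)
  else if (i : ℕ) = m then C (2 * Complex.I * (Real.sqrt m : ℂ)) * X ^ m
  else C Complex.I * X ^ (i : ℕ) - C Complex.I * X ^ (2 * m - i)

theorem C_I_mul_C_I : (C Complex.I * C Complex.I : ℂ[X]) = -1 := by
  rw [← C_mul, Complex.I_mul_I, C_neg, C_1]

theorem isotropicCurve_sq_add_sq_rev (m : ℕ) (i : Fin (2 * m + 1)) :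
    isotropicCurve m i ^ 2 + isotropicCurve m i.rev ^ 2 =
      C (if (i : ℕ) = m then -8 * (m : ℂ) else 4) * X ^ (2 * m) := by
  have hi := i.2
  have hrev : (i.rev : ℕ) = 2 * m - i := by rw [Fin.val_rev]; omega
  have hsq : (Real.sqrt m : ℂ) ^ 2 = m := by
    rw [← Complex.ofReal_pow, Real.sq_sqrt (Nat.cast_nonneg m), Complex.ofReal_natCast]
  have hI := C_I_mul_C_I
  rcases lt_trichotomy (i : ℕ) m with h | h | h
  · have hX : (X : ℂ[X]) ^ (2 * m) = X ^ (i : ℕ) * X ^ (2 * m - i : ℕ) := by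
      rw [← pow_add]; congr 1; omega
    rw [isotropicCurve, isotropicCurve, if_pos h, if_neg (by omega), if_neg (by omega),
      if_neg h.ne, hrev, show 2 * m - (2 * m - i) = (i : ℕ) by omega, hX]
    simp only [map_ofNat]
    linear_combination (X ^ (2 * m - (i : ℕ)) - X ^ (i : ℕ)) ^ 2 * hI
  · rw [isotropicCurve, isotropicCurve, if_neg (by omega), if_pos h, if_neg (by omega),
      if_pos (by omega), if_pos h, ← two_mul, mul_pow, ← C_pow, mul_pow, mul_pow, Complex.I_sq, hsq,
      ← pow_mul, mul_comm m 2, ← mul_assoc]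
    congr 1
    rw [← C_ofNat, ← C_mul]
    congr 1
    ring
  · have hX : (X : ℂ[X]) ^ (2 * m) = X ^ (i : ℕ) * X ^ (2 * m - i : ℕ) := by
      rw [← pow_add]; congr 1; omega
    rw [isotropicCurve, isotropicCurve, if_neg (by omega), if_neg h.ne', if_pos (by omega),
      if_neg h.ne', hrev, show 2 * m - (2 * m - i) = (i : ℕ) by omega, hX]
    simp only [map_ofNat]
    linear_combination (X ^ (2 * m - (i : ℕ)) - X ^ (i : ℕ)) ^ 2 * hI

theorem sum_isotropicCurve_sq (m : ℕ) : ∑ i, isotropicCurve m i ^ 2 = 0 := by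
  have h1 : ∑ i : Fin (2 * m + 1), isotropicCurve m i.rev ^ 2 = ∑ i, isotropicCurve m i ^ 2 :=
    Equiv.sum_comp Fin.revPerm fun i => isotropicCurve m i ^ 2
  have h2 : ∑ i : Fin (2 * m + 1), (if (i : ℕ) = m then -8 * (m : ℂ) else 4) = 0 := by
    have h3 : ∀ i : Fin (2 * m + 1), (if (i : ℕ) = m then -8 * (m : ℂ) else 4) =
        4 + if i = ⟨m, by omega⟩ then -8 * (m : ℂ) - 4 else 0 := by
      intro i
      simp only [Fin.ext_iff]
      split_ifs <;> ring
    simp only [h3, Finset.sum_add_distrib, Finset.sum_ite_eq', Finset.mem_univ, if_true]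
    simp
    ring
  have h4 : 2 * ∑ i, isotropicCurve m i ^ 2 = 0 := by
    rw [two_mul]
    nth_rewrite 2 [← h1]
    rw [← Finset.sum_add_distrib]
    simp only [isotropicCurve_sq_add_sq_rev]
    rw [← Finset.sum_mul, ← map_sum, h2, map_zero, zero_mul]
  exact (mul_eq_zero.1 h4).resolve_left two_ne_zero

theorem isotropicCurve_mem_degreeLT (m : ℕ) (i : Fin (2 * m + 1)) :
    isotropicCurve m i ∈ degreeLT ℂ (2 * m + 1) := by
  have hX : ∀ k < 2 * m + 1, ∀ c : ℂ, C c * (X : ℂ[X]) ^ k ∈ degreeLT ℂ (2 * m + 1) := by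
    intro k hk c
    rw [mem_degreeLT]
    exact (degree_C_mul_X_pow_le k c).trans_lt (by exact_mod_cast hk)
  have hX' : ∀ k < 2 * m + 1, (X : ℂ[X]) ^ k ∈ degreeLT ℂ (2 * m + 1) := by
    intro k hk
    simpa using hX k hk 1
  have hi := i.2
  rw [isotropicCurve]
  split_ifs
  · exact add_mem (hX' _ hi) (hX' _ (by omega))
  · exact hX _ (by omega) _
  · exact sub_mem (hX _ hi _) (hX _ (by omega) _)

theorem span_range_isotropicCurve {m : ℕ} (hm : 0 < m) :
    Submodule.span ℂ (Set.range (isotropicCurve m)) = degreeLT ℂ (2 * m + 1) := by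
  classical
  apply le_antisymm
  · rw [Submodule.span_le]
    rintro _ ⟨i, rfl⟩
    exact isotropicCurve_mem_degreeLT m i
  · rw [degreeLT_eq_span_X_pow, Submodule.span_le]
    have hmem : ∀ i, isotropicCurve m i ∈ Submodule.span ℂ (Set.range (isotropicCurve m)) :=
      fun i => Submodule.subset_span ⟨i, rfl⟩
    have hlow : ∀ k < m, (X : ℂ[X]) ^ k ∈ Submodule.span ℂ (Set.range (isotropicCurve m)) ∧
        (X : ℂ[X]) ^ (2 * m - k) ∈ Submodule.span ℂ (Set.range (isotropicCurve m)) := by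
      intro k hk
      have h1 : isotropicCurve m ⟨k, by omega⟩ = X ^ k + X ^ (2 * m - k) := by
        simp [isotropicCurve, hk]
      have h2 : isotropicCurve m ⟨2 * m - k, by omega⟩ =
          C Complex.I * X ^ (2 * m - k) - C Complex.I * X ^ k := by
        have h3 : ¬ 2 * m - k < m := by omega
        have h4 : ¬ 2 * m - k = m := by omega
        have h5 : 2 * m - (2 * m - k) = k := by omega
        simp [isotropicCurve, h3, h4, h5]
      have hC : (C (1 / 2) * 2 : ℂ[X]) = 1 := by
        rw [← C_ofNat, ← C_mul]; norm_num
      have h6 : (X : ℂ[X]) ^ k = (1 / 2 : ℂ) • isotropicCurve m ⟨k, by omega⟩ +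
          (Complex.I / 2) • isotropicCurve m ⟨2 * m - k, by omega⟩ := by
        rw [h1, h2, smul_eq_C_mul, smul_eq_C_mul, show Complex.I / 2 = 1 / 2 * Complex.I by ring,
          C_mul]
        linear_combination -X ^ k * hC - C (1 / 2) * (X ^ (2 * m - k) - X ^ k) * C_I_mul_C_I
      have h7 : (X : ℂ[X]) ^ (2 * m - k) = (1 / 2 : ℂ) • isotropicCurve m ⟨k, by omega⟩ -
          (Complex.I / 2) • isotropicCurve m ⟨2 * m - k, by omega⟩ := by
        rw [h1, h2, smul_eq_C_mul, smul_eq_C_mul, show Complex.I / 2 = 1 / 2 * Complex.I by ring,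
          C_mul]
        linear_combination -X ^ (2 * m - k) * hC +
          C (1 / 2) * (X ^ (2 * m - k) - X ^ k) * C_I_mul_C_I
      refine ⟨?_, ?_⟩
      · rw [h6]
        exact add_mem (Submodule.smul_mem _ _ (hmem _)) (Submodule.smul_mem _ _ (hmem _))
      · rw [h7]
        exact sub_mem (Submodule.smul_mem _ _ (hmem _)) (Submodule.smul_mem _ _ (hmem _))
    intro p hp
    simp only [Finset.coe_image, Set.mem_image, Finset.coe_range, Set.mem_Iio] at hp
    obtain ⟨k, hk, rfl⟩ := hp
    rcases lt_trichotomy k m with h | rfl | h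
    · exact (hlow k h).1
    · have h1 : isotropicCurve k ⟨k, by omega⟩ = C (2 * Complex.I * (Real.sqrt k : ℂ)) * X ^ k := by
        simp [isotropicCurve]
      have h2 : (2 * Complex.I * (Real.sqrt k : ℂ)) ≠ 0 := by
        have : Real.sqrt k ≠ 0 := (Real.sqrt_pos.2 (Nat.cast_pos.2 hm)).ne'
        simp [this]
      have h3 := Submodule.smul_mem _ (2 * Complex.I * (Real.sqrt k : ℂ))⁻¹ (hmem ⟨k, by omega⟩)
      rwa [h1, smul_eq_C_mul, ← mul_assoc, ← C_mul, inv_mul_cancel₀ h2, C_1, one_mul] at h3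
    · have := (hlow (2 * m - k) (by omega)).2
      rwa [show 2 * m - (2 * m - k) = k by omega] at this

theorem linearIndependent_isotropicCurve {m : ℕ} (hm : 0 < m) :
    LinearIndependent ℂ (isotropicCurve m) := by
  rw [linearIndependent_iff_card_eq_finrank_span, Set.finrank, span_range_isotropicCurve hm,
    (degreeLTEquiv ℂ (2 * m + 1)).finrank_eq]
  simp

/-- The point of the curve with the parameter `z`. -/
def curvePoint (m : ℕ) (z : ℂ) (i : Fin (2 * m + 1)) : ℂ := (isotropicCurve m i).eval z

/-- The polynomial that a linear form restricts to on the curve. -/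
def restrictForm (m : ℕ) : Module.Dual ℂ (Fin (2 * m + 1) → ℂ) →ₗ[ℂ] ℂ[X] :=
  ∑ i, (LinearMap.toSpanSingleton ℂ ℂ[X] (isotropicCurve m i)).comp
    (LinearMap.applyₗ (Pi.single i (1 : ℂ)))

theorem restrictForm_apply (m : ℕ) (L : Module.Dual ℂ (Fin (2 * m + 1) → ℂ)) :
    restrictForm m L = ∑ i, L (Pi.single i 1) • isotropicCurve m i := by
  simp [restrictForm]

theorem eval_restrictForm (m : ℕ) (L : Module.Dual ℂ (Fin (2 * m + 1) → ℂ)) (z : ℂ) :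
    (restrictForm m L).eval z = L (curvePoint m z) := by
  rw [restrictForm_apply, eval_finsetSum, LinearMap.pi_apply_eq_sum_univ]
  refine Finset.sum_congr rfl fun i _ => ?_
  rw [eval_smul, smul_eq_mul, smul_eq_mul, mul_comm, curvePoint]
  congr 2
  funext j
  simp [Pi.single_apply, eq_comm]

theorem restrictForm_injective {m : ℕ} (hm : 0 < m) : Function.Injective (restrictForm m) := by
  rw [← LinearMap.ker_eq_bot, LinearMap.ker_eq_bot']
  intro L hL
  rw [restrictForm_apply] at hL
  have h := Fintype.linearIndependent_iff.1 (linearIndependent_isotropicCurve hm) _ hL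
  refine LinearMap.pi_ext' fun i => LinearMap.ext_ring ?_
  simpa using h i

theorem exists_restrictForm_eq {m : ℕ} (hm : 0 < m) {p : ℂ[X]}
    (hp : p ∈ degreeLT ℂ (2 * m + 1)) : ∃ L, restrictForm m L = p := by
  rw [← span_range_isotropicCurve hm, Submodule.mem_span_range_iff_exists_fun] at hp
  obtain ⟨c, hc⟩ := hp
  refine ⟨∑ i, c i • LinearMap.proj i, ?_⟩
  rw [restrictForm_apply, ← hc]
  refine Finset.sum_congr rfl fun i _ => ?_
  congr 1
  simp [Pi.single_apply]

end IsotropicCurve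

/-! ### The Riemann sphere -/

section RiemannSphere

open OnePoint MinimalSurface

/-- The coordinate of a map between Riemann surfaces in the preferred charts computes its
derivative. -/
theorem hasMFDerivAt_of_hasDerivAt {M N : Type*} [TopologicalSpace M] [ChartedSpace ℂ M]
    [TopologicalSpace N] [ChartedSpace ℂ N] {f : M → N} {p : M} {d : ℂ} (hf : ContinuousAt f p)
    (h : HasDerivAt (fun w => chartAt ℂ (f p) (f ((chartAt ℂ p).symm w))) d (chartAt ℂ p p)) :
    HasMFDerivAt 𝓘(ℂ) 𝓘(ℂ) f p (ContinuousLinearMap.toSpanSingleton ℂ d : ℂ →L[ℂ] ℂ) := by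
  have key : HasFDerivWithinAt (writtenInExtChartAt 𝓘(ℂ) 𝓘(ℂ) p f : ℂ → ℂ)
      (ContinuousLinearMap.toSpanSingleton ℂ d : ℂ →L[ℂ] ℂ) (Set.range 𝓘(ℂ))
      (extChartAt 𝓘(ℂ) p p) := by
    simpa [writtenInExtChartAt, Function.comp_def] using h.hasFDerivAt
  exact ⟨hf, key⟩

/-- The coordinate `z` on the Riemann sphere. -/
def sphereChartZero : OpenPartialHomeomorph (OnePoint ℂ) ℂ :=
  (isOpenEmbedding_coe.toOpenPartialHomeomorph ((↑) : ℂ → OnePoint ℂ)).symm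

/-- The map `z ↦ 1 / z` of the Riemann sphere. -/
def sphereInv (p : OnePoint ℂ) : OnePoint ℂ :=
  p.elim ((0 : ℂ) : OnePoint ℂ) fun z => if z = 0 then infty else ((z⁻¹ : ℂ) : OnePoint ℂ)

theorem sphereInv_coe {z : ℂ} (hz : z ≠ 0) : sphereInv z = (z⁻¹ : ℂ) := by
  simp [sphereInv, hz]

theorem sphereInv_coe_zero : sphereInv ((0 : ℂ) : OnePoint ℂ) = infty := by
  simp [sphereInv]

theorem sphereInv_infty : sphereInv infty = ((0 : ℂ) : OnePoint ℂ) := rfl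

theorem sphereInv_involutive : Function.Involutive sphereInv := by
  intro p
  induction p using OnePoint.rec with
  | infty => rw [sphereInv_infty, sphereInv_coe_zero]
  | coe z =>
    by_cases hz : z = 0
    · rw [hz, sphereInv_coe_zero, sphereInv_infty]
    · rw [sphereInv_coe hz, sphereInv_coe (inv_ne_zero hz), inv_inv]

theorem continuous_sphereInv : Continuous sphereInv := by
  rw [continuous_iff_continuousAt]
  have h0 : Filter.Tendsto (fun z : ℂ => ((z⁻¹ : ℂ) : OnePoint ℂ)) (𝓝[≠] 0) (𝓝 infty) := by
    have h1 : Filter.Tendsto ((↑) : ℂ → OnePoint ℂ) (Filter.cocompact ℂ) (𝓝 infty) := by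
      rw [← Filter.coclosedCompact_eq_cocompact]
      exact tendsto_coe_infty
    refine h1.comp ?_
    rw [← Metric.cobounded_eq_cocompact]
    exact Filter.tendsto_inv₀_nhdsNE_zero
  intro p
  induction p using OnePoint.rec with
  | infty =>
    rw [continuousAt_infty', sphereInv_infty]
    have h1 : Filter.Tendsto (fun z : ℂ => ((z⁻¹ : ℂ) : OnePoint ℂ)) (Filter.cocompact ℂ)
        (𝓝 ((0 : ℂ) : OnePoint ℂ)) := by
      refine (continuous_coe.tendsto (0 : ℂ)).comp ?_
      rw [← Metric.cobounded_eq_cocompact]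
      exact Filter.tendsto_inv₀_cobounded
    rw [Filter.coclosedCompact_eq_cocompact]
    refine h1.congr' ?_
    have : ∀ᶠ z : ℂ in Filter.cocompact ℂ, z ≠ 0 :=
      (isCompact_singleton (x := (0 : ℂ))).compl_mem_cocompact
    filter_upwards [this] with z hz
    exact (sphereInv_coe hz).symm
  | coe z =>
    rw [continuousAt_coe]
    by_cases hz : z = 0
    · subst hz
      rw [continuousAt_iff_punctured_nhds]
      simp only [Function.comp_apply, sphereInv_coe_zero]
      refine h0.congr' ?_
      filter_upwards [self_mem_nhdsWithin] with w hw
      exact (sphereInv_coe hw).symm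
    · have h1 : ContinuousAt (fun w : ℂ => ((w⁻¹ : ℂ) : OnePoint ℂ)) z :=
        continuous_coe.continuousAt.comp (continuousAt_inv₀ hz)
      refine h1.congr ?_
      filter_upwards [isOpen_ne.mem_nhds hz] with w hw
      exact (sphereInv_coe hw).symm

/-- The inversion as a homeomorphism of the Riemann sphere. -/
def sphereInvHomeomorph : OnePoint ℂ ≃ₜ OnePoint ℂ where
  toEquiv := sphereInv_involutive.toPerm
  continuous_toFun := continuous_sphereInv
  continuous_invFun := continuous_sphereInv

/-- The coordinate `1 / z` on the Riemann sphere. -/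
def sphereChartInfty : OpenPartialHomeomorph (OnePoint ℂ) ℂ :=
  sphereInvHomeomorph.toOpenPartialHomeomorph.trans sphereChartZero

theorem sphereChartZero_source : sphereChartZero.source = Set.range ((↑) : ℂ → OnePoint ℂ) := by
  simp [sphereChartZero]

theorem sphereChartZero_symm_apply (w : ℂ) : sphereChartZero.symm w = (w : OnePoint ℂ) := by
  simp [sphereChartZero]

theorem sphereChartZero_coe (z : ℂ) : sphereChartZero (z : OnePoint ℂ) = z :=
  isOpenEmbedding_coe.toOpenPartialHomeomorph_left_inv ((↑) : ℂ → OnePoint ℂ)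

theorem sphereChartInfty_apply (p : OnePoint ℂ) :
    sphereChartInfty p = sphereChartZero (sphereInv p) := rfl

theorem sphereChartInfty_symm_apply (w : ℂ) : sphereChartInfty.symm w = sphereInv w := by
  simp only [sphereChartInfty, OpenPartialHomeomorph.coe_trans_symm, Function.comp_apply,
    sphereChartZero_symm_apply]
  rfl

theorem mem_sphereChartInfty_source (p : OnePoint ℂ) :
    p ∈ sphereChartInfty.source ↔ p ≠ ((0 : ℂ) : OnePoint ℂ) := by
  have h1 : p ∈ sphereChartInfty.source ↔ sphereInv p ∈ sphereChartZero.source := by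
    simp [sphereChartInfty]
    rfl
  rw [h1, sphereChartZero_source, ← not_iff_not, notMem_range_coe_iff, not_not,
    ← sphereInv_coe_zero, sphereInv_involutive.injective.eq_iff]

instance : ChartedSpace ℂ (OnePoint ℂ) where
  atlas := {sphereChartZero, sphereChartInfty}
  chartAt p := p.elim sphereChartInfty fun _ => sphereChartZero
  mem_chart_source p := by
    induction p using OnePoint.rec with
    | infty => exact (mem_sphereChartInfty_source _).2 (infty_ne_coe 0)
    | coe z =>
      rw [elim_some, sphereChartZero_source]
      exact ⟨z, rfl⟩
  chart_mem_atlas p := by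
    induction p using OnePoint.rec with
    | infty => exact Or.inr rfl
    | coe z => exact Or.inl rfl

theorem chartAt_coe (z : ℂ) : chartAt ℂ (z : OnePoint ℂ) = sphereChartZero := rfl

theorem chartAt_infty : chartAt ℂ (infty : OnePoint ℂ) = sphereChartInfty := rfl

instance : RiemannSurface (OnePoint ℂ) where
  toIsManifold := by
    have hinv : ContDiffOn ℂ ω (fun w : ℂ => w⁻¹) {0}ᶜ := fun w hw =>
      (contDiffAt_inv ℂ hw).contDiffWithinAt
    apply isManifold_of_contDiffOn
    rintro e e' (rfl | rfl) (rfl | rfl)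
    · refine contDiffOn_id.congr fun w hw => ?_
      simp [sphereChartZero_symm_apply, sphereChartZero_coe]
    · have hw0 : ∀ w ∈ (sphereChartZero.symm ≫ₕ sphereChartInfty).source, w ≠ 0 := by
        rintro w hw rfl
        rw [OpenPartialHomeomorph.trans_source] at hw
        have := hw.2
        rw [Set.mem_preimage, sphereChartZero_symm_apply, mem_sphereChartInfty_source] at this
        exact this rfl
      refine (hinv.mono fun w hw => hw0 w (by simpa using hw)).congr fun w hw => ?_
      have := hw0 w (by simpa using hw)
      simp [sphereChartZero_symm_apply, sphereChartZero_coe, sphereChartInfty_apply,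
        sphereInv_coe this]
    · have hw0 : ∀ w ∈ (sphereChartInfty.symm ≫ₕ sphereChartZero).source, w ≠ 0 := by
        rintro w hw rfl
        rw [OpenPartialHomeomorph.trans_source] at hw
        have := hw.2
        rw [Set.mem_preimage, sphereChartInfty_symm_apply, sphereInv_coe_zero,
          sphereChartZero_source] at this
        exact infty_notMem_range_coe this
      refine (hinv.mono fun w hw => hw0 w (by simpa using hw)).congr fun w hw => ?_
      have := hw0 w (by simpa using hw)
      simp [sphereChartInfty_symm_apply, sphereChartZero_coe, sphereInv_coe this]
    · refine contDiffOn_id.congr fun w hw => ?_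
      simp [sphereChartInfty_symm_apply, sphereChartInfty_apply, sphereInv_involutive w,
        sphereChartZero_coe]
  toT2Space := inferInstance
  toConnectedSpace := inferInstance

theorem hasMFDerivAt_coe (z : ℂ) : HasMFDerivAt 𝓘(ℂ) 𝓘(ℂ) ((↑) : ℂ → OnePoint ℂ) z
    (ContinuousLinearMap.toSpanSingleton ℂ (1 : ℂ) : ℂ →L[ℂ] ℂ) := by
  refine hasMFDerivAt_of_hasDerivAt continuous_coe.continuousAt ?_
  simp only [chartAt_coe, chartAt_self_eq, OpenPartialHomeomorph.refl_symm,
    OpenPartialHomeomorph.refl_apply, sphereChartZero_coe]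
  exact hasDerivAt_id z

theorem hasMFDerivAt_sphereInv_coe {w : ℂ} (hw : w ≠ 0) :
    HasMFDerivAt 𝓘(ℂ) 𝓘(ℂ) (fun w : ℂ => sphereInv w) w
      (ContinuousLinearMap.toSpanSingleton ℂ (-(w ^ 2)⁻¹) : ℂ →L[ℂ] ℂ) := by
  refine hasMFDerivAt_of_hasDerivAt (continuous_sphereInv.comp continuous_coe).continuousAt ?_
  simp only [chartAt_self_eq, OpenPartialHomeomorph.refl_symm,
    OpenPartialHomeomorph.refl_apply, sphereInv_coe hw, chartAt_coe]
  refine (hasDerivAt_inv hw).congr_of_eventuallyEq ?_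
  filter_upwards [isOpen_ne.mem_nhds hw] with v hv
  rw [id, sphereInv_coe hv, sphereChartZero_coe]

/-- The form `f(z) dz` on the Riemann sphere; its value at `∞` is irrelevant. -/
def sphereForm (f : ℂ → ℂ) (q : OnePoint ℂ) : TangentSpace 𝓘(ℂ) q →L[ℂ] ℂ :=
  (q.elim 0 f) • ContinuousLinearMap.id ℂ ℂ

theorem formCoeff_sphereForm_coe (f : ℂ → ℂ) (z : ℂ) :
    formCoeff (sphereForm f) (z : OnePoint ℂ) = f := by
  funext w
  have h : ((chartAt ℂ (z : OnePoint ℂ)).symm : ℂ → OnePoint ℂ) = (↑) :=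
    funext sphereChartZero_symm_apply
  simp only [formCoeff]
  rw [h, (hasMFDerivAt_coe w).mfderiv]
  change f w * ((1 : ℂ) * 1) = f w
  ring

theorem formCoeff_sphereForm_infty (f : ℂ → ℂ) {w : ℂ} (hw : w ≠ 0) :
    formCoeff (sphereForm f) (infty : OnePoint ℂ) w = f w⁻¹ * -(w ^ 2)⁻¹ := by
  have h : ((chartAt ℂ (infty : OnePoint ℂ)).symm : ℂ → OnePoint ℂ) = fun w : ℂ => sphereInv w :=
    funext sphereChartInfty_symm_apply
  simp only [formCoeff]
  rw [h, (hasMFDerivAt_sphereInv_coe hw).mfderiv]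
  change (sphereInv w).elim 0 f * (1 * -(w ^ 2)⁻¹) = _
  rw [sphereInv_coe hw, elim_some, one_mul]

end RiemannSphere

/-! ### Isotropic vectors -/

section Isotropic

variable {n : ℕ}

/-- The real linear map `v ↦ Re (v c)`. -/
def reMul (c : Fin n → ℂ) : ℂ →L[ℝ] EuclideanSpace ℝ (Fin n) :=
  (PiLp.continuousLinearEquiv 2 ℝ (fun _ : Fin n => ℝ)).symm.toContinuousLinearMap.comp
    (ContinuousLinearMap.pi fun i => Complex.reCLM.comp
      ((ContinuousLinearMap.toSpanSingleton ℂ (c i)).restrictScalars ℝ))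

theorem reMul_apply (c : Fin n → ℂ) (v : ℂ) (i : Fin n) : reMul c v i = (v * c i).re := by
  simp [reMul]

theorem hasFDerivAt_toLp_re {G : Fin n → ℂ → ℂ} {g : Fin n → ℂ} {w : ℂ}
    (h : ∀ i, HasDerivAt (G i) (g i) w) :
    HasFDerivAt (fun w => WithLp.toLp 2 fun i => (G i w).re : ℂ → EuclideanSpace ℝ (Fin n))
      (reMul g) w := by
  have h1 : HasFDerivAt (fun w => fun i => (G i w).re) (ContinuousLinearMap.pi fun i =>
      Complex.reCLM.comp ((ContinuousLinearMap.toSpanSingleton ℂ (g i)).restrictScalars ℝ)) w :=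
    hasFDerivAt_pi.2 fun i =>
      Complex.reCLM.hasFDerivAt.comp w ((h i).hasFDerivAt.restrictScalars ℝ)
  exact (PiLp.hasFDerivAt_toLp 2 _).comp w h1

theorem inner_reMul (c : Fin n → ℂ) (v w : ℂ) :
    inner ℝ (reMul c v) (reMul c w) = ∑ i, (v * c i).re * (w * c i).re := by
  rw [PiLp.inner_apply]
  refine Finset.sum_congr rfl fun i _ => ?_
  rw [reMul_apply, reMul_apply]
  simp [mul_comm]

/-- An isotropic vector `c` defines a conformal map `v ↦ Re (v c)`. -/
theorem inner_reMul_of_isotropic {c : Fin n → ℂ} (hc : ∑ i, c i ^ 2 = 0) (v w : ℂ) :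
    2 * inner ℝ (reMul c v) (reMul c w) = (∑ i, ‖c i‖ ^ 2) * (v * starRingEnd ℂ w).re := by
  have h1 : ∑ i, (v * w * c i ^ 2).re = 0 := by
    rw [← Complex.re_sum, ← Finset.mul_sum, hc, mul_zero, Complex.zero_re]
  have h2 : ∀ i, 2 * ((v * c i).re * (w * c i).re) =
      ‖c i‖ ^ 2 * (v * starRingEnd ℂ w).re + (v * w * c i ^ 2).re := by
    intro i
    rw [Complex.sq_norm, Complex.normSq_apply, sq (c i)]
    simp only [Complex.mul_re, Complex.mul_im, Complex.conj_re, Complex.conj_im]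
    ring
  rw [inner_reMul, Finset.mul_sum, Finset.sum_congr rfl fun i _ => h2 i, Finset.sum_add_distrib, h1,
    add_zero, Finset.sum_mul]

theorem norm_mul_sq_le_of_isotropic {c : Fin n → ℂ} (hc : ∑ i, c i ^ 2 = 0) (v : ℂ) (i : Fin n) :
    ‖v * c i‖ ^ 2 ≤ 2 * ‖reMul c v‖ ^ 2 := by
  rw [← real_inner_self_eq_norm_sq (reMul c v), inner_reMul_of_isotropic hc, Complex.mul_conj,
    Complex.ofReal_re, Complex.normSq_eq_norm_sq, norm_mul, mul_pow, mul_comm]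
  refine mul_le_mul_of_nonneg_right ?_ (sq_nonneg _)
  exact Finset.single_le_sum (f := fun i => ‖c i‖ ^ 2) (fun i _ => sq_nonneg _) (Finset.mem_univ i)

end Isotropic

/-! ### Minimal surfaces over a global coordinate -/

section GlobalCoordinate

open MinimalSurface

variable {X : Type*} [TopologicalSpace X] {n : ℕ}

/-- The complex structure on `X` for which the local homeomorphism `π` is a coordinate near every
point. -/
@[reducible]
def IsLocalHomeomorph.etaleChartedSpace {π : X → ℂ} (h : IsLocalHomeomorph π) :
    ChartedSpace ℂ X where
  atlas := {e | ⇑e = π}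
  chartAt p := (h p).choose
  mem_chart_source p := (h p).choose_spec.1
  chart_mem_atlas p := (h p).choose_spec.2.symm

theorem isManifold_of_atlas_coe_eq [ChartedSpace ℂ X] {π : X → ℂ}
    (hπ : ∀ e ∈ atlas ℂ X, ⇑e = π) : IsManifold 𝓘(ℂ) ω X := by
  apply isManifold_of_contDiffOn
  intro e e' he he'
  refine contDiffOn_id.congr fun w hw => ?_
  have hw' : w ∈ e.target := by
    have := hw.1
    simp only [Set.mem_preimage, OpenPartialHomeomorph.trans_source] at this
    simpa using this.1
  have h1 : e' (e.symm w) = w := by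
    rw [hπ e' he', ← hπ e he]
    exact e.right_inv hw'
  simpa using h1

/-- `F` is a primitive of `f dz`, where `z` is the coordinate given by the charts. -/
def IsPrimitive [ChartedSpace ℂ X] (F : X → ℂ) (f : ℂ → ℂ) : Prop :=
  ∀ p, ∀ w ∈ (chartAt ℂ p).target, HasDerivAt (F ∘ (chartAt ℂ p).symm) (f w) w

theorem IsPrimitive.sum [ChartedSpace ℂ X] {ι : Type*} (s : Finset ι) (c : ι → ℂ) {F : ι → X → ℂ}
    {f : ι → ℂ → ℂ} (h : ∀ i ∈ s, IsPrimitive (F i) (f i)) :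
    IsPrimitive (fun p => ∑ i ∈ s, c i * F i p) (fun z => ∑ i ∈ s, c i * f i z) := by
  intro p w hw
  exact HasDerivAt.fun_sum fun i hi => (h i hi p w hw).const_mul (c i)

/-- Branches of the logarithm of `z - a` are primitives of `dz / (z - a)`. -/
theorem isPrimitive_of_exp_eq [ChartedSpace ℂ X] {π : X → ℂ} (hπ : ∀ p, ⇑(chartAt ℂ p) = π)
    {F : X → ℂ} (hF : Continuous F) {a : ℂ} (h : ∀ p, Complex.exp (F p) = π p - a) :
    IsPrimitive F (fun z => (z - a)⁻¹) := by
  intro p w hw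
  have hright : ∀ v ∈ (chartAt ℂ p).target, Complex.exp (F ((chartAt ℂ p).symm v)) = v - a := by
    intro v hv
    rw [h, ← hπ p, (chartAt ℂ p).right_inv hv]
  have hcont : ContinuousAt (F ∘ (chartAt ℂ p).symm) w :=
    hF.continuousAt.comp ((chartAt ℂ p).continuousAt_symm hw)
  have hexp : HasDerivAt (fun z => Complex.exp z + a) (w - a) ((F ∘ (chartAt ℂ p).symm) w) := by
    have := (Complex.hasDerivAt_exp (F ((chartAt ℂ p).symm w))).add_const a
    rwa [hright w hw] at this
  refine hexp.of_local_left_inverse hcont ?_ ?_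
  · rw [← hright w hw]
    exact Complex.exp_ne_zero _
  · filter_upwards [(chartAt ℂ p).open_target.mem_nhds hw] with v hv
    simp only [Function.comp_apply]
    rw [hright v hv, sub_add_cancel]

/-- On a simply connected surface every function without zeros has a continuous logarithm. -/
theorem exists_continuous_exp_eq [SimplyConnectedSpace X] [LocallyPathConnectedSpace X]
    {g : X → ℂ} (hg : Continuous g) (h0 : ∀ p, g p ≠ 0) :
    ∃ F : X → ℂ, Continuous F ∧ ∀ p, Complex.exp (F p) = g p := by
  obtain ⟨p₀⟩ : Nonempty X := inferInstance
  obtain ⟨F, ⟨-, hF⟩, -⟩ := Complex.isCoveringMap_exp.existsUnique_continuousMap_lifts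
    (⟨fun p => ⟨g p, h0 p⟩, hg.subtype_mk _⟩ : C(X, {z : ℂ // z ≠ 0})) p₀ (Complex.log (g p₀))
    (Subtype.ext (Complex.exp_log (h0 p₀)))
  exact ⟨F, F.continuous, fun p => congrArg Subtype.val (congrFun hF p)⟩

/-- The Weierstrass data of a minimal surface on a surface with a global coordinate `z = π`: the
functions `F i` are primitives of the forms `f i dz`, which satisfy `∑ i, (f i) ^ 2 = 0` and have no
common zeros. -/
structure IsWeierstrassData [ChartedSpace ℂ X] (π : X → ℂ) (F : Fin n → X → ℂ)
    (f : Fin n → ℂ → ℂ) : Prop where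
  coord : ∀ p, ⇑(chartAt ℂ p) = π
  primitive : ∀ i, IsPrimitive (F i) (f i)
  isotropic : ∀ p, ∑ i, f i (π p) ^ 2 = 0
  exists_ne_zero : ∀ p, ∃ i, f i (π p) ≠ 0

/-- The surface with coordinates `Re (F i)`. -/
def reSurface (F : Fin n → X → ℂ) (p : X) : EuclideanSpace ℝ (Fin n) :=
  WithLp.toLp 2 fun i => (F i p).re

namespace IsWeierstrassData

variable [ChartedSpace ℂ X] {π : X → ℂ} {F : Fin n → X → ℂ} {f : Fin n → ℂ → ℂ}

theorem coord_mem_target (h : IsWeierstrassData π F f) (p : X) : π p ∈ (chartAt ℂ p).target := by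
  rw [← h.coord p]
  exact mem_chart_target ℂ p

theorem hasFDerivAt_localExpr (h : IsWeierstrassData π F f) (p : X) {w : ℂ}
    (hw : w ∈ (chartAt ℂ p).target) :
    HasFDerivAt (localExpr (reSurface F) p) (reMul fun i => f i w) w :=
  hasFDerivAt_toLp_re fun i => h.primitive i p w hw

theorem partialDeriv_eq (h : IsWeierstrassData π F f) (p : X) (a : ℂ) :
    partialDeriv (reSurface F) p a = reMul (fun i => f i (π p)) a := by
  rw [partialDeriv, h.coord p, (h.hasFDerivAt_localExpr p (h.coord_mem_target p)).fderiv]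

theorem firstForm_eq (h : IsWeierstrassData π F f) (p : X) (a b : ℂ) :
    2 * firstForm (reSurface F) p a b =
      (∑ i, ‖f i (π p)‖ ^ 2) * (a * starRingEnd ℂ b).re := by
  rw [firstForm, h.partialDeriv_eq, h.partialDeriv_eq, inner_reMul_of_isotropic (h.isotropic p)]

theorem gaussVector_eq (h : IsWeierstrassData π F f) (p : X) :
    gaussVector (reSurface F) p = fun i => f i (π p) := by
  funext i
  rw [gaussVector, h.partialDeriv_eq, h.partialDeriv_eq, reMul_apply, reMul_apply]
  apply Complex.ext <;> simp

theorem analyticAt (h : IsWeierstrassData π F f) (p : X) (i : Fin n) :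
    AnalyticAt ℂ (F i ∘ (chartAt ℂ p).symm) (π p) := by
  have h1 : DifferentiableOn ℂ (F i ∘ (chartAt ℂ p).symm) (chartAt ℂ p).target := fun w hw =>
    (h.primitive i p w hw).differentiableAt.differentiableWithinAt
  exact h1.analyticAt ((chartAt ℂ p).open_target.mem_nhds (h.coord_mem_target p))

theorem analyticAt_form (h : IsWeierstrassData π F f) (p : X) (i : Fin n) :
    AnalyticAt ℂ (f i) (π p) := by
  refine (h.analyticAt p i).deriv.congr ?_
  filter_upwards [(chartAt ℂ p).open_target.mem_nhds (h.coord_mem_target p)] with w hw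
  exact (h.primitive i p w hw).deriv

theorem isConformalImmersion (h : IsWeierstrassData π F f) :
    IsConformalImmersion (reSurface F) where
  smooth p := by
    have h1 : ∀ i, ContDiffAt ℝ ∞ (fun w => (F i ((chartAt ℂ p).symm w)).re) (π p) := fun i =>
      Complex.reCLM.contDiff.contDiffAt.comp _ ((h.analyticAt p i).contDiffAt.restrict_scalars ℝ)
    have h2 : ContDiffAt ℝ ∞ (localExpr (reSurface F) p) (chartAt ℂ p p) := by
      rw [h.coord p]
      exact contDiffAt_euclidean.2 h1
    rw [contMDiffAt_iff]
    refine ⟨?_, ?_⟩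
    · have h3 : ContinuousAt (localExpr (reSurface F) p ∘ chartAt ℂ p) p :=
        h2.continuousAt.comp ((chartAt ℂ p).continuousAt (mem_chart_source ℂ p))
      refine h3.congr ?_
      filter_upwards [(chartAt ℂ p).open_source.mem_nhds (mem_chart_source ℂ p)] with q hq
      simp [localExpr, (chartAt ℂ p).left_inv hq]
    · rw [extChartAt_model_space_eq_id]
      have h4 := h2.contDiffWithinAt (s := Set.univ)
      simpa [localExpr, Function.comp_def] using h4
  immersion p := by
    obtain ⟨i, hi⟩ := h.exists_ne_zero p
    rw [h.partialDeriv_eq, h.partialDeriv_eq, LinearIndependent.pair_iff]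
    intro s t hst
    have h1 : reMul (fun i => f i (π p)) (s + t * Complex.I) = 0 := by
      rw [← hst, ← map_smul, ← map_smul, ← map_add]
      simp
    have h2 := norm_mul_sq_le_of_isotropic (h.isotropic p) (s + t * Complex.I) i
    rw [h1, norm_zero, zero_pow two_ne_zero, mul_zero] at h2
    have h3 := pow_eq_zero_iff two_ne_zero |>.1 (le_antisymm h2 (sq_nonneg _))
    have h4 := (mul_eq_zero.1 (norm_eq_zero.1 h3)).resolve_right hi
    exact ⟨by simpa using congrArg Complex.re h4, by simpa using congrArg Complex.im h4⟩
  conformal p := by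
    have h1 := h.firstForm_eq p 1 1
    have h2 := h.firstForm_eq p Complex.I Complex.I
    have h3 := h.firstForm_eq p 1 Complex.I
    simp at h1 h2 h3
    exact ⟨by linarith, h3⟩

theorem partialDeriv₂_eq (h : IsWeierstrassData π F f) (p : X) (a b : ℂ) :
    partialDeriv₂ (reSurface F) p a b = reMul (fun i => deriv (f i) (π p)) (a * b) := by
  have h1 : (fun w => fderiv ℝ (localExpr (reSurface F) p) w b) =ᶠ[𝓝 (π p)]
      fun w => WithLp.toLp 2 fun i => (b * f i w).re := by
    filter_upwards [(chartAt ℂ p).open_target.mem_nhds (h.coord_mem_target p)] with w hw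
    rw [(h.hasFDerivAt_localExpr p hw).fderiv]
    ext i
    rw [reMul_apply]
  have h2 := hasFDerivAt_toLp_re fun i =>
    (h.analyticAt_form p i).differentiableAt.hasDerivAt.const_mul b
  rw [partialDeriv₂, h.coord p, (h2.congr_of_eventuallyEq h1).fderiv]
  ext i
  rw [reMul_apply, reMul_apply, mul_assoc]

theorem isMinimal (h : IsWeierstrassData π F f) : IsMinimal (reSurface F) := by
  intro p N _ _
  obtain ⟨h1, h2⟩ := h.isConformalImmersion.conformal p
  have h3 : secondForm (reSurface F) p N Complex.I Complex.I =
      -secondForm (reSurface F) p N 1 1 := by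
    rw [secondForm, secondForm, h.partialDeriv₂_eq, h.partialDeriv₂_eq, Complex.I_mul_I, mul_one,
      map_neg, inner_neg_left]
  rw [meanCurvature, h1, h2, h3]
  simp

end IsWeierstrassData

end GlobalCoordinate

/-! ### Completeness -/

section Completeness

open MinimalSurface MeasureTheory

/-- A curve in `ℂ` of finite length converges; its speed is controlled by a function `g` of finite
integral. -/
theorem exists_tendsto_of_norm_deriv_le {E : Type*} [NormedAddCommGroup E] {u : ℝ → ℂ} {g : ℝ → E}
    {P : Set ℝ} {c : ℝ} (hu : ContinuousOn u (Set.Ico 0 1))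
    (hP : ∀ b < 1, (P ∩ Set.Icc 0 b).Finite) (hg : AEStronglyMeasurable g)
    (hfin : ∫⁻ t in Set.Ico (0 : ℝ) 1, ‖g t‖ₑ ≠ ⊤)
    (hd : ∀ t ∈ Set.Ioo (0 : ℝ) 1 \ P, DifferentiableAt ℝ u t ∧ ‖deriv u t‖ ≤ c * ‖g t‖) :
    ∃ l, Filter.Tendsto u (𝓝[<] 1) (𝓝 l) := by
  have hPc : (P ∩ Set.Ico 0 1).Countable := by
    refine (Set.countable_iUnion fun k : ℕ => (hP (1 - 1 / ((k : ℝ) + 1)) ?_).countable).mono ?_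
    · have : 0 < 1 / ((k : ℝ) + 1) := Nat.one_div_pos_of_nat
      linarith
    · rintro t ⟨htP, ht0, ht1⟩
      obtain ⟨k, hk⟩ := exists_nat_one_div_lt (sub_pos.2 ht1)
      exact Set.mem_iUnion.2 ⟨k, htP, ht0, by linarith⟩
  have hint : IntegrableOn (deriv u) (Set.Ico 0 1) := by
    have h1 : IntegrableOn (fun t => c * ‖g t‖) (Set.Ico 0 1) :=
      (Integrable.norm ⟨hg.restrict, hfin.lt_top⟩).const_mul c
    refine Integrable.mono' h1 (measurable_deriv u).aestronglyMeasurable ?_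
    have h2 : ∀ᵐ t : ℝ, t ∉ P ∩ Set.Ico 0 1 := measure_eq_zero_iff_ae_notMem.1 (hPc.measure_zero _)
    have h3 : ∀ᵐ t : ℝ, t ≠ 0 := by simp [ae_iff]
    rw [ae_restrict_iff' measurableSet_Ico]
    filter_upwards [h2, h3] with t ht ht0 htI
    exact (hd t ⟨⟨lt_of_le_of_ne htI.1 (Ne.symm ht0), htI.2⟩, fun h => ht ⟨h, htI⟩⟩).2
  have hint' : IntegrableOn (deriv u) (Set.uIcc 0 1) := by
    rwa [Set.uIcc_of_le zero_le_one, integrableOn_Icc_iff_integrableOn_Ico]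
  have hFTC : ∀ t ∈ Set.Ico (0 : ℝ) 1, u 0 + ∫ s in (0 : ℝ)..t, deriv u s = u t := by
    intro t ht
    rw [integral_eq_of_hasDerivAt_off_countable_of_le u (deriv u) ht.1 (hP t ht.2).countable
      (hu.mono (Set.Icc_subset_Ico_right ht.2))]
    · ring
    · intro s hs
      exact (hd s ⟨⟨hs.1.1, hs.1.2.trans ht.2⟩,
        fun h => hs.2 ⟨h, hs.1.1.le, hs.1.2.le⟩⟩).1.hasDerivAt
    · rw [intervalIntegrable_iff_integrableOn_Ico_of_le ht.1]
      exact hint.mono_set (Set.Ico_subset_Ico_right ht.2.le)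
  have hprim := (intervalIntegral.continuousOn_primitive_interval hint').const_add (u 0) 1
    Set.right_mem_uIcc
  refine ⟨_, Filter.Tendsto.congr' ?_ (hprim.mono_left (y := 𝓝[<] 1) ?_)⟩
  · rw [← nhdsWithin_Ico_eq_nhdsLT zero_lt_one]
    filter_upwards [self_mem_nhdsWithin] with t ht
    exact hFTC t ht
  · rw [← nhdsWithin_Ico_eq_nhdsLT zero_lt_one, Set.uIcc_of_le zero_le_one]
    exact nhdsWithin_mono _ Set.Ico_subset_Icc_self

/-- A curve in a covering space whose projection converges stays in a compact set. -/
theorem IsCoveringMap.exists_isCompact_of_tendsto {X B : Type*} [TopologicalSpace X]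
    [TopologicalSpace B] {p : X → B} (hp : IsCoveringMap p) {γ : ℝ → X}
    (hγ : ContinuousOn γ (Set.Ico 0 1)) {z : B}
    (hz : Filter.Tendsto (p ∘ γ) (𝓝[<] 1) (𝓝 z)) :
    ∃ K, IsCompact K ∧ ∀ t ∈ Set.Ico (0 : ℝ) 1, γ t ∈ K := by
  classical
  have hcont : ContinuousOn (Function.update (p ∘ γ) 1 z) (Set.Icc 0 1) := by
    rw [continuousOn_update_iff, Set.Icc_sdiff_right]
    refine ⟨hp.continuous.comp_continuousOn hγ, fun _ => ?_⟩
    rwa [nhdsWithin_Ico_eq_nhdsLT zero_lt_one]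
  let σ : C(unitInterval, B) := ⟨(Set.Icc (0 : ℝ) 1).domRestrict (Function.update (p ∘ γ) 1 z),
    hcont.domRestrict⟩
  have hσ : ∀ t : unitInterval, (t : ℝ) ≠ 1 → σ t = p (γ t) := fun t ht =>
    Function.update_of_ne ht _ _
  obtain ⟨Γ, hΓ, hΓ0⟩ := hp.exists_path_lifts σ (γ 0) (hσ 0 zero_ne_one)
  refine ⟨Set.range Γ, isCompact_range Γ.continuous, fun t ht => ?_⟩
  have heq : Set.EqOn γ (Γ ∘ Set.projIcc 0 1 zero_le_one) (Set.Ico 0 1) := by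
    refine hp.eqOn_of_comp_eqOn isPreconnected_Ico hγ
      (Γ.continuous.comp continuous_projIcc).continuousOn ?_ (a := 0) ⟨le_rfl, zero_lt_one⟩ ?_
    · intro s hs
      have h1 := congrFun hΓ (Set.projIcc 0 1 zero_le_one s)
      simp only [Function.comp_apply] at h1 ⊢
      rw [h1, Set.projIcc_of_mem zero_le_one ⟨hs.1, hs.2.le⟩, hσ _ hs.2.ne]
    · rw [Function.comp_apply, Set.projIcc_left]
      exact hΓ0.symm
  rw [heq ht]
  exact ⟨_, rfl⟩

variable {X : Type*} [TopologicalSpace X] [ChartedSpace ℂ X] {π : X → ℂ} {n : ℕ}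

/-- A differentiable curve has a velocity in the global coordinate. -/
theorem differentiableAt_coord_comp (hπ : ∀ p, ⇑(chartAt ℂ p) = π) {γ : ℝ → X} {t : ℝ}
    (hγ : ContMDiffAt 𝓘(ℝ, ℝ) 𝓘(ℝ, ℂ) 1 γ t) : DifferentiableAt ℝ (π ∘ γ) t := by
  have h1 := (contMDiffAt_iff.1 hγ).2
  have h2 : ContDiffAt ℝ 1 (π ∘ γ) t := by
    rw [extChartAt_model_space_eq_id] at h1
    rw [← hπ (γ t), ← contDiffWithinAt_univ]
    simpa [Function.comp_def] using h1
  exact h2.differentiableAt one_ne_zero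

theorem comp_symm_comp_eventuallyEq (hπ : ∀ p, ⇑(chartAt ℂ p) = π) {Y : Type*} (F : X → Y)
    {γ : ℝ → X} {t : ℝ} (hγ : ContinuousAt γ t) :
    F ∘ γ =ᶠ[𝓝 t] (F ∘ (chartAt ℂ (γ t)).symm) ∘ (π ∘ γ) := by
  filter_upwards [hγ.preimage_mem_nhds
    ((chartAt ℂ (γ t)).open_source.mem_nhds (mem_chart_source ℂ (γ t)))] with s hs
  simp only [Function.comp_apply]
  rw [← hπ (γ t), (chartAt ℂ (γ t)).left_inv hs]

theorem IsPrimitive.hasDerivAt_comp (hπ : ∀ p, ⇑(chartAt ℂ p) = π) {F : X → ℂ} {f : ℂ → ℂ}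
    (hF : IsPrimitive F f) {γ : ℝ → X} {t : ℝ} (hγ : ContMDiffAt 𝓘(ℝ, ℝ) 𝓘(ℝ, ℂ) 1 γ t) :
    HasDerivAt (F ∘ γ) (deriv (π ∘ γ) t * f (π (γ t))) t := by
  have hw : (π ∘ γ) t ∈ (chartAt ℂ (γ t)).target := by
    rw [Function.comp_apply, ← hπ (γ t)]
    exact mem_chart_target ℂ (γ t)
  have h1 := ((hF (γ t) _ hw).hasFDerivAt.restrictScalars ℝ).comp_hasDerivAt t
    (differentiableAt_coord_comp hπ hγ).hasDerivAt
  refine HasDerivAt.congr_deriv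
    (h1.congr_of_eventuallyEq (comp_symm_comp_eventuallyEq hπ F hγ.continuousAt)) ?_
  simp

theorem IsWeierstrassData.hasDerivAt_reSurface_comp {F : Fin n → X → ℂ} {f : Fin n → ℂ → ℂ}
    (h : IsWeierstrassData π F f) {γ : ℝ → X} {t : ℝ}
    (hγ : ContMDiffAt 𝓘(ℝ, ℝ) 𝓘(ℝ, ℂ) 1 γ t) :
    HasDerivAt (reSurface F ∘ γ) (reMul (fun i => f i (π (γ t))) (deriv (π ∘ γ) t)) t := by
  have hw : (π ∘ γ) t ∈ (chartAt ℂ (γ t)).target := h.coord_mem_target (γ t)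
  have h1 := (h.hasFDerivAt_localExpr (γ t) hw).comp_hasDerivAt t
    (differentiableAt_coord_comp h.coord hγ).hasDerivAt
  exact h1.congr_of_eventuallyEq (comp_symm_comp_eventuallyEq h.coord _ hγ.continuousAt)

/-- If every `1 / (z - a)`, `a ∈ A`, is a linear combination of the `f i`, then a curve of finite
length has a finite length in the metrics `|dz| / |z - a|` too, so it converges to a point outside
`A` and, the projection being a covering, does not leave every compact set. -/
theorem IsWeierstrassData.isCompleteSurface {F : Fin n → X → ℂ} {f : Fin n → ℂ → ℂ}
    (h : IsWeierstrassData π F f) {A : Finset ℂ} (hA : A.Nonempty) {p : X → ((A : Set ℂ)ᶜ : Set ℂ)}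
    (hp : IsCoveringMap p) (hpπ : ∀ q, (p q : ℂ) = π q) {G : ℂ → X → ℂ}
    (hG : ∀ a ∈ A, Continuous (G a) ∧ ∀ q, Complex.exp (G a q) = π q - a)
    (hf : ∀ a ∈ A, ∃ c : Fin n → ℂ, ∀ q, (π q - a)⁻¹ = ∑ i, c i * f i (π q)) :
    IsCompleteSurface (reSurface F) := by
  intro γ P hγ hP hdiff hesc
  by_contra hlen
  have hlim : ∀ a ∈ A, ∃ l, Filter.Tendsto (π ∘ γ) (𝓝[<] 1) (𝓝 (a + Complex.exp l)) := by
    intro a ha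
    obtain ⟨c, hc⟩ := hf a ha
    obtain ⟨hGc, hGe⟩ := hG a ha
    obtain ⟨l, hl⟩ : ∃ l, Filter.Tendsto (G a ∘ γ) (𝓝[<] 1) (𝓝 l) := by
      refine exists_tendsto_of_norm_deriv_le (c := ∑ i, ‖c i‖ * 2) (hGc.comp_continuousOn hγ) hP
        (stronglyMeasurable_deriv (reSurface F ∘ γ)).aestronglyMeasurable hlen fun t ht => ?_
      have h1 := (isPrimitive_of_exp_eq h.coord hGc hGe).hasDerivAt_comp h.coord (hdiff t ht)
      refine ⟨h1.differentiableAt, ?_⟩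
      rw [h1.deriv, (h.hasDerivAt_reSurface_comp (hdiff t ht)).deriv, hc, Finset.mul_sum,
        Finset.sum_mul]
      refine (norm_sum_le _ _).trans (Finset.sum_le_sum fun i _ => ?_)
      have h2 := norm_mul_sq_le_of_isotropic (h.isotropic (γ t)) (deriv (π ∘ γ) t) i
      have h3 : ‖deriv (π ∘ γ) t * f i (π (γ t))‖ ≤
          2 * ‖reMul (fun i => f i (π (γ t))) (deriv (π ∘ γ) t)‖ := by
        refine abs_le_of_sq_le_sq' ?_ (by positivity) |>.2
        nlinarith [sq_nonneg ‖reMul (fun i => f i (π (γ t))) (deriv (π ∘ γ) t)‖]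
      rw [mul_left_comm, norm_mul, mul_assoc]
      exact mul_le_mul_of_nonneg_left h3 (norm_nonneg _)
    refine ⟨l, ?_⟩
    refine (((Complex.continuous_exp.tendsto l).comp hl).const_add a).congr fun t => ?_
    simp only [Function.comp_apply]
    rw [hGe]
    ring
  obtain ⟨a₀, ha₀⟩ := hA
  obtain ⟨l₀, hl₀⟩ := hlim a₀ ha₀
  have hz : a₀ + Complex.exp l₀ ∈ (A : Set ℂ)ᶜ := by
    intro hmem
    obtain ⟨l, hl⟩ := hlim _ hmem
    have := tendsto_nhds_unique hl hl₀
    exact Complex.exp_ne_zero l (by simp at this)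
  have hzp : Filter.Tendsto (p ∘ γ) (𝓝[<] 1) (𝓝 ⟨_, hz⟩) := by
    rw [tendsto_subtype_rng]
    simpa [Function.comp_def, hpπ] using hl₀
  obtain ⟨K, hK, hγK⟩ := hp.exists_isCompact_of_tendsto hγ hzp
  have h1 : ∀ᶠ t in 𝓝[<] (1 : ℝ), γ t ∈ Kᶜ := hesc hK.compl_mem_cocompact
  have h2 : ∀ᶠ t in 𝓝[<] (1 : ℝ), t ∈ Set.Ico (0 : ℝ) 1 := by
    rw [← nhdsWithin_Ico_eq_nhdsLT zero_lt_one]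
    exact self_mem_nhdsWithin
  obtain ⟨t, ht1, ht2⟩ := (h1.and h2).exists
  exact ht1 (hγK t ht2)

end Completeness

/-! ### The universal covering of a punctured plane -/

section PuncturedPlane

open OnePoint MinimalSurface

theorem relSimplyConnectedBasis_of_isOpen {s : Set ℂ} (hs : IsOpen s) :
    RelSimplyConnectedBasis s := by
  refine ⟨fun x U hU => ?_⟩
  obtain ⟨t, ht, htU⟩ := mem_nhds_induced _ x U |>.1 hU
  obtain ⟨ε, hε, hball⟩ := Metric.mem_nhds_iff.1 (Filter.inter_mem ht (hs.mem_nhds x.2))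
  let i : C(Metric.ball (x : ℂ) ε, s) :=
    ⟨fun w => ⟨w, (hball w.2).2⟩, continuous_subtype_val.subtype_mk _⟩
  have hconv : Convex ℝ (Metric.ball (x : ℂ) ε) := convex_ball _ _
  have hcontr : ContractibleSpace (Metric.ball (x : ℂ) ε) :=
    hconv.contractibleSpace ⟨x, Metric.mem_ball_self hε⟩
  have hrange : Set.range i = Subtype.val ⁻¹' Metric.ball (x : ℂ) ε := by
    ext w
    exact ⟨fun ⟨v, hv⟩ => hv ▸ v.2, fun hw => ⟨⟨w, hw⟩, rfl⟩⟩
  refine ⟨Subtype.val ⁻¹' Metric.ball (x : ℂ) ε, ⟨?_, ?_, ?_⟩, Metric.mem_ball_self hε,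
    fun w hw => htU (hball hw).1⟩
  · exact Metric.isOpen_ball.preimage continuous_subtype_val
  · rw [← hrange]
    exact isPathConnected_range i.continuous
  · intro y z p q hp hq
    have hy : (y : ℂ) ∈ Metric.ball (x : ℂ) ε := p.source ▸ hp 0
    have hz : (z : ℂ) ∈ Metric.ball (x : ℂ) ε := p.target ▸ hp 1
    let p' : Path (⟨y, hy⟩ : Metric.ball (x : ℂ) ε) ⟨z, hz⟩ :=
      { toFun := fun t => ⟨p t, hp t⟩
        source' := by simp
        target' := by simp }
    let q' : Path (⟨y, hy⟩ : Metric.ball (x : ℂ) ε) ⟨z, hz⟩ :=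
      { toFun := fun t => ⟨q t, hq t⟩
        source' := by simp
        target' := by simp }
    exact (SimplyConnectedSpace.paths_homotopic p' q').map i

/-- The plane without the points of the finite set `A`. -/
abbrev PuncturedPlane (A : Finset ℂ) : Type := ((A : Set ℂ)ᶜ : Set ℂ)

variable {A : Finset ℂ}

theorem isOpen_compl_finset (A : Finset ℂ) : IsOpen (A : Set ℂ)ᶜ :=
  A.finite_toSet.isClosed.isOpen_compl

instance : RelSimplyConnectedBasis (PuncturedPlane A) :=
  relSimplyConnectedBasis_of_isOpen (isOpen_compl_finset A)

instance : PathConnectedSpace (PuncturedPlane A) :=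
  isPathConnected_iff_pathConnectedSpace.1 <|
    A.finite_toSet.countable.isPathConnected_compl_of_one_lt_rank (by simp)

namespace UniversalCovering

variable {x₀ : PuncturedPlane A}

theorem surjective_proj : Function.Surjective (proj : UniversalCovering x₀ → PuncturedPlane A) :=
  fun y => ⟨⟨y, .mk (PathConnectedSpace.somePath x₀ y)⟩, rfl⟩

/-- The coordinate `z` of the plane, as a function on the universal covering of the punctured
plane. -/
def coord (q : UniversalCovering x₀) : ℂ := q.proj

theorem coord_sub_ne_zero (q : UniversalCovering x₀) {a : ℂ} (ha : a ∈ A) : coord q - a ≠ 0 :=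
  sub_ne_zero.2 fun h => q.proj.2 (by rw [← coord, h]; exact ha)

theorem isLocalHomeomorph_coord : IsLocalHomeomorph (coord : UniversalCovering x₀ → ℂ) :=
  (isOpen_compl_finset A).isOpenEmbedding_subtypeVal.isLocalHomeomorph.comp
    isCoveringMap_proj.isLocalHomeomorph

theorem continuous_coord : Continuous (coord : UniversalCovering x₀ → ℂ) :=
  isLocalHomeomorph_coord.continuous

instance : ChartedSpace ℂ (UniversalCovering x₀) := isLocalHomeomorph_coord.etaleChartedSpace

theorem chartAt_eq_coord (q : UniversalCovering x₀) : ⇑(chartAt ℂ q) = coord :=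
  chart_mem_atlas ℂ q

instance : RiemannSurface (UniversalCovering x₀) where
  toIsManifold := isManifold_of_atlas_coe_eq fun _ he => he
  toT2Space := by
    refine ⟨fun p q hpq => ?_⟩
    by_cases h : p.proj = q.proj
    · exact isCoveringMap_proj.isSeparatedMap p q h hpq
    · exact separated_by_continuous continuous_proj h
  toConnectedSpace := inferInstance

/-- The universal covering of the punctured plane, as a map to the Riemann sphere. -/
def toSphere (q : UniversalCovering x₀) : OnePoint ℂ := (coord q : OnePoint ℂ)

theorem hasMFDerivAt_toSphere (q : UniversalCovering x₀) :
    HasMFDerivAt 𝓘(ℂ) 𝓘(ℂ) toSphere q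
      (ContinuousLinearMap.toSpanSingleton ℂ (1 : ℂ) : ℂ →L[ℂ] ℂ) := by
  refine hasMFDerivAt_of_hasDerivAt (continuous_coe.comp continuous_coord).continuousAt ?_
  refine (hasDerivAt_id _).congr_of_eventuallyEq ?_
  filter_upwards [(chartAt ℂ q).open_target.mem_nhds (mem_chart_target ℂ q)] with w hw
  have h := (chartAt ℂ q).right_inv hw
  rw [chartAt_eq_coord] at h
  rw [toSphere, chartAt_coe, toSphere, sphereChartZero_coe, h, id]

end UniversalCovering

/-- The points of the Riemann sphere that are missing from the plane punctured at `A`. -/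
def sphereEnds (A : Finset ℂ) : Set (OnePoint ℂ) := insert infty ((↑) '' (A : Set ℂ))

theorem finite_sphereEnds (A : Finset ℂ) : (sphereEnds A).Finite :=
  (A.finite_toSet.image _).insert _

theorem compl_sphereEnds (A : Finset ℂ) :
    (sphereEnds A)ᶜ = ((↑) : ℂ → OnePoint ℂ) '' (A : Set ℂ)ᶜ := by
  ext p
  induction p using OnePoint.rec with
  | infty => simp [sphereEnds]
  | coe z => simp [sphereEnds]

theorem isPuncturedPlane_sphereEnds (hA : A.Nonempty) : IsPuncturedPlane (sphereEnds A) := by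
  refine ⟨A, (↑), hA, fun z _ => (hasMFDerivAt_coe z).mdifferentiableAt.mdifferentiableWithinAt, ?_⟩
  rw [compl_sphereEnds]
  exact (coe_injective.injOn).bijOn_image

theorem IsEvenlyCovered.isOpenEmbedding_comp {E B Y I : Type*} [TopologicalSpace E]
    [TopologicalSpace B] [TopologicalSpace Y] [TopologicalSpace I] {f : E → B} {x : B}
    (h : IsEvenlyCovered f x I) {g : B → Y} (hg : Topology.IsOpenEmbedding g) :
    IsEvenlyCovered (g ∘ f) (g x) I :=
  have ⟨inst, U, hxU, hU, hfU, H, hH⟩ := h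
  have hpre : g ∘ f ⁻¹' (g '' U) = f ⁻¹' U := by
    rw [Set.preimage_comp, Set.preimage_image_eq _ hg.injective]
  ⟨inst, g '' U, ⟨x, hxU, rfl⟩, hg.isOpenMap _ hU, by rwa [hpre],
    .trans (.setCongr hpre)
      (H.trans <| .prodCongr (hg.isEmbedding.homeomorphImage U) (.refl I)),
    fun _ => congr_arg g (hH _)⟩

namespace UniversalCovering

variable {x₀ : PuncturedPlane A}

theorem range_toSphere : Set.range (toSphere : UniversalCovering x₀ → _) = (sphereEnds A)ᶜ := by
  rw [compl_sphereEnds]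
  ext p
  constructor
  · rintro ⟨q, rfl⟩
    exact ⟨_, q.proj.2, rfl⟩
  · rintro ⟨z, hz, rfl⟩
    obtain ⟨q, hq⟩ := surjective_proj (x₀ := x₀) ⟨z, hz⟩
    exact ⟨q, by rw [toSphere, coord, hq]⟩

theorem isCoveringMapOn_toSphere :
    IsCoveringMapOn (toSphere : UniversalCovering x₀ → _) (sphereEnds A)ᶜ := by
  rw [compl_sphereEnds]
  rintro _ ⟨z, hz, rfl⟩
  exact ((isCoveringMap_proj ⟨z, hz⟩).isOpenEmbedding_comp
    (isOpenEmbedding_coe.comp (isOpen_compl_finset A).isOpenEmbedding_subtypeVal)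
    ).to_isEvenlyCovered_preimage

theorem exists_logarithm (a : ℂ) (ha : a ∈ A) :
    ∃ G : UniversalCovering x₀ → ℂ, Continuous G ∧ ∀ q, Complex.exp (G q) = coord q - a := by
  have := ChartedSpace.locallyPathConnectedSpace ℂ (UniversalCovering x₀)
  exact exists_continuous_exp_eq (continuous_coord.sub continuous_const)
    fun q => coord_sub_ne_zero q ha

end UniversalCovering

end PuncturedPlane

/-! ### Meromorphic forms with the rational normal curve as Gauss map -/

section RationalCurve

open Polynomial MinimalSurface OnePoint

variable {m : ℕ} {A : Finset ℂ}

/-- The residue at `a` of the rational function `isotropicCurve m i / ∏ b ∈ A, (z - b)`. -/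
def curveResidue (A : Finset ℂ) (m : ℕ) (i : Fin (2 * m + 1)) (a : ℂ) : ℂ :=
  Lagrange.nodalWeight A id a * (isotropicCurve m i).eval a

/-- The rational function `isotropicCurve m i / ∏ b ∈ A, (z - b)` by its partial fractions. -/
def curveForm (A : Finset ℂ) (m : ℕ) (i : Fin (2 * m + 1)) (z : ℂ) : ℂ :=
  ∑ a ∈ A, curveResidue A m i a * (z - a)⁻¹

theorem eval_nodal_ne_zero {z : ℂ} (hz : z ∉ A) : (Lagrange.nodal A id).eval z ≠ 0 := by
  rw [Lagrange.eval_nodal, Finset.prod_ne_zero_iff]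
  rintro a ha h
  exact hz (by rwa [sub_eq_zero.1 h])

/-- As the degrees of the curve are less than `A.card`, it is interpolated by its values on `A`. -/
theorem curveForm_eq (hA : A.card = 2 * m + 1) {z : ℂ} (hz : z ∉ A) :
    (fun i => curveForm A m i z) = ((Lagrange.nodal A id).eval z)⁻¹ • curvePoint m z := by
  funext i
  have hdeg : (isotropicCurve m i).degree < A.card := by
    rw [hA]
    exact mem_degreeLT.1 (isotropicCurve_mem_degreeLT m i)
  have h1 := Lagrange.eq_interpolate (v := id) (Function.injective_id.injOn) hdeg
  have h2 := Lagrange.eval_interpolate_not_at_node (s := A) (v := id) (x := z)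
    (fun a => (isotropicCurve m i).eval (id a)) (fun a ha h => hz (by rw [h]; exact ha))
  rw [← h1] at h2
  rw [Pi.smul_apply, smul_eq_mul, curvePoint, h2, inv_mul_cancel_left₀ (eval_nodal_ne_zero hz)]
  refine Finset.sum_congr rfl fun a _ => ?_
  simp only [curveResidue, id]
  ring

theorem sum_curveForm_sq (hA : A.card = 2 * m + 1) {z : ℂ} (hz : z ∉ A) :
    ∑ i, curveForm A m i z ^ 2 = 0 := by
  have h : ∀ i, curveForm A m i z = ((Lagrange.nodal A id).eval z)⁻¹ * curvePoint m z i :=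
    fun i => congrFun (curveForm_eq hA hz) i
  have h2 := congrArg (eval z) (sum_isotropicCurve_sq m)
  simp only [eval_finsetSum, eval_pow, eval_zero] at h2
  simp only [h, mul_pow, ← Finset.mul_sum, curvePoint, h2, mul_zero]

/-- The curve spans the polynomials of degree less than `A.card`, among them
`∏ b ∈ A.erase a, (z - b)`. -/
theorem exists_inv_sub_eq_sum_curveForm (hm : 0 < m) (hA : A.card = 2 * m + 1) {a : ℂ}
    (ha : a ∈ A) :
    ∃ c : Fin (2 * m + 1) → ℂ, ∀ z ∉ A, (z - a)⁻¹ = ∑ i, c i * curveForm A m i z := by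
  have hp : Lagrange.nodal (A.erase a) id ∈ degreeLT ℂ (2 * m + 1) := by
    rw [mem_degreeLT, Lagrange.degree_nodal, Finset.card_erase_of_mem ha, hA]
    exact_mod_cast Nat.lt_succ_self _
  obtain ⟨L, hL⟩ := exists_restrictForm_eq hm hp
  refine ⟨fun i => L (Pi.single i 1), fun z hz => ?_⟩
  have h1 : ∑ i, L (Pi.single i 1) * curveForm A m i z = L (fun i => curveForm A m i z) := by
    rw [LinearMap.pi_apply_eq_sum_univ L]
    refine Finset.sum_congr rfl fun i _ => ?_
    rw [smul_eq_mul, mul_comm]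
    congr 2
    ext j
    simp [Pi.single_apply, eq_comm]
  have h2 : (Lagrange.nodal A id).eval z = (z - a) * (Lagrange.nodal (A.erase a) id).eval z := by
    rw [Lagrange.nodal_eq_mul_nodal_erase ha, eval_mul]
    simp
  have h3 : (Lagrange.nodal (A.erase a) id).eval z ≠ 0 :=
    eval_nodal_ne_zero fun h => hz (Finset.mem_of_mem_erase h)
  rw [h1, curveForm_eq hA hz, _root_.map_smul, ← eval_restrictForm, hL, smul_eq_mul, h2, mul_inv,
    inv_mul_cancel_right₀ h3]

theorem isHolomorphicFormOn_curveForm (i : Fin (2 * m + 1)) :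
    IsHolomorphicFormOn (sphereForm (curveForm A m i)) (sphereEnds A)ᶜ := by
  rw [compl_sphereEnds]
  rintro _ ⟨z, hz, rfl⟩
  rw [formCoeff_sphereForm_coe, chartAt_coe, sphereChartZero_coe]
  refine Finset.analyticAt_fun_sum _ fun a ha => ?_
  refine analyticAt_const.mul ((analyticAt_id.sub analyticAt_const).inv ?_)
  exact sub_ne_zero.2 fun h => hz (by rw [show z = a from h]; exact ha)

theorem isMeromorphicForm_curveForm (i : Fin (2 * m + 1)) :
    IsMeromorphicForm (sphereForm (curveForm A m i)) := by
  intro p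
  induction p using OnePoint.rec with
  | infty =>
    rw [chartAt_infty, sphereChartInfty_apply, sphereInv_infty, sphereChartZero_coe]
    have h : MeromorphicAt (fun w : ℂ => curveForm A m i w⁻¹ * -(w ^ 2)⁻¹) 0 := by
      unfold curveForm
      fun_prop
    refine h.congr ?_
    filter_upwards [self_mem_nhdsWithin] with w hw
    exact (formCoeff_sphereForm_infty _ hw).symm
  | coe z =>
    rw [formCoeff_sphereForm_coe]
    unfold curveForm
    fun_prop

/-- The functions `∑ a ∈ A, curveResidue A m i a * log (z - a)` for given branches `G a` of
`log (z - a)`. -/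
def curvePrimitive {X : Type*} (A : Finset ℂ) (m : ℕ) (G : ℂ → X → ℂ) (i : Fin (2 * m + 1))
    (q : X) : ℂ :=
  ∑ a ∈ A, curveResidue A m i a * G a q

open UniversalCovering

variable {x₀ : PuncturedPlane A} {G : ℂ → UniversalCovering x₀ → ℂ}

theorem isWeierstrassData_curvePrimitive (hm : 0 < m) (hA : A.card = 2 * m + 1)
    (hG : ∀ a ∈ A, Continuous (G a) ∧ ∀ q, Complex.exp (G a q) = coord q - a) :
    IsWeierstrassData coord (curvePrimitive A m G) (curveForm A m) where
  coord := chartAt_eq_coord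
  primitive i := IsPrimitive.sum A _ fun a ha =>
    isPrimitive_of_exp_eq chartAt_eq_coord (hG a ha).1 (hG a ha).2
  isotropic q := sum_curveForm_sq hA q.proj.2
  exists_ne_zero q := by
    obtain ⟨a, ha⟩ : A.Nonempty := Finset.card_pos.1 (by omega)
    obtain ⟨c, hc⟩ := exists_inv_sub_eq_sum_curveForm hm hA ha
    by_contra! h
    have h1 := hc (UniversalCovering.coord q) q.proj.2
    simp only [h, mul_zero, Finset.sum_const_zero, inv_eq_zero] at h1
    exact coord_sub_ne_zero q ha h1

theorem isPseudoAlgebraic_curvePrimitive (hm : 0 < m) (hA : A.card = 2 * m + 1)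
    (hG : ∀ a ∈ A, Continuous (G a) ∧ ∀ q, Complex.exp (G a q) = coord q - a) :
    IsPseudoAlgebraic (reSurface (curvePrimitive A m G)) (sphereEnds A)
      (toSphere : UniversalCovering x₀ → OnePoint ℂ) := by
  have h := isWeierstrassData_curvePrimitive hm hA hG
  refine
    { conformalImmersion := h.isConformalImmersion
      minimal := h.isMinimal
      complete := ?_
      finite_punctures := finite_sphereEnds A
      holomorphic := fun q => (hasMFDerivAt_toSphere q).mdifferentiableAt
      range_eq := range_toSphere
      covering := isCoveringMapOn_toSphere
      forms := ⟨fun i => sphereForm (curveForm A m i), isHolomorphicFormOn_curveForm,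
        isMeromorphicForm_curveForm, fun i q => ?_⟩ }
  · refine h.isCompleteSurface (Finset.card_pos.1 (by omega)) isCoveringMap_proj (fun _ => rfl) hG
      fun a ha => ?_
    obtain ⟨c, hc⟩ := exists_inv_sub_eq_sum_curveForm hm hA ha
    exact ⟨c, fun q => hc _ q.proj.2⟩
  · rw [(hasMFDerivAt_toSphere q).mfderiv, weierstrassForm, h.gaussVector_eq]
    ext
    change curveForm A m i (coord q) * 1 = curveForm A m i (coord q) * (1 * 1)
    ring

end RationalCurve

/-! ### The hyperplanes -/

section Hyperplanes

open Polynomial MinimalSurface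

theorem mk_mem_hyperplane_iff {n : ℕ} (L : Module.Dual ℂ (Fin n → ℂ)) {v : Fin n → ℂ}
    (hv : v ≠ 0) : Projectivization.mk ℂ v hv ∈ hyperplane L ↔ L v = 0 := by
  obtain ⟨a, ha⟩ := Projectivization.exists_smul_eq_mk_rep ℂ v hv
  change L (Projectivization.mk ℂ v hv).rep = 0 ↔ _
  rw [← ha, Units.smul_def, map_smul, smul_eq_zero]
  simp

variable {X : Type*} [TopologicalSpace X] [ChartedSpace ℂ X] {m : ℕ} {A : Finset ℂ}

theorem gaussMap_mem_hyperplane_iff {x : X → EuclideanSpace ℝ (Fin (2 * m + 1))}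
    (hx : IsConformalImmersion x) {p : X} {c z : ℂ} (hc : c ≠ 0)
    (h : gaussVector x p = c • curvePoint m z) (L : Module.Dual ℂ (Fin (2 * m + 1) → ℂ)) :
    gaussMap hx p ∈ hyperplane L ↔ (restrictForm m L).eval z = 0 := by
  rw [gaussMap, mk_mem_hyperplane_iff, h, map_smul, eval_restrictForm, smul_eq_zero]
  simp [hc]

/-- A linear form that vanishes at infinitely many points of the rational normal curve is zero. -/
theorem eq_zero_of_eval_restrictForm (hm : 0 < m) {L : Module.Dual ℂ (Fin (2 * m + 1) → ℂ)}
    (h : ∀ z ∉ A, (restrictForm m L).eval z = 0) : L = 0 := by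
  have hinf : (A : Set ℂ)ᶜ.Infinite := A.finite_toSet.infinite_compl
  refine restrictForm_injective hm ?_
  rw [map_zero]
  exact eq_zero_of_infinite_isRoot _ (hinf.mono fun z hz => h z hz)

theorem inGeneralPosition_of_anyIndependent {ι : Type*} {q : ℕ} {v : ι → ℂ[X]}
    (hv : AnyIndependent (2 * m + 1) v) (e : Fin q ≃ ι)
    {L : Fin q → Module.Dual ℂ (Fin (2 * m + 1) → ℂ)} (hL : ∀ j, restrictForm m (L j) = v (e j)) :
    InGeneralPosition L := by
  classical
  constructor
  · intro j h0
    have h1 : LinearIndepOn ℂ v ({e j} : Finset ι) := hv {e j} (by simp)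
    rw [Finset.coe_singleton, linearIndepOn_singleton_iff] at h1
    rw [← hL j, h0, map_zero] at h1
    exact h1 rfl
  · intro μ hμ
    have h1 := hv (Finset.univ.image (e ∘ μ)) (Finset.card_image_le.trans (by simp))
    rw [Finset.coe_image, Finset.coe_univ, Set.image_univ,
      linearIndepOn_range_iff (e.injective.comp hμ)] at h1
    refine LinearIndependent.of_comp (restrictForm m) ?_
    convert h1 using 1
    funext j
    exact hL (μ j)

end Hyperplanes

end

open MinimalSurface
theorem mainTheorem6 (n : ℕ) (hn : Odd n) (hn3 : 3 ≤ n) :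
    ∃ (X : Type) (_ : TopologicalSpace X) (_ : ChartedSpace ℂ X) (_ : RiemannSurface X)
      (Mbar : Type) (_ : TopologicalSpace Mbar) (_ : ChartedSpace ℂ Mbar)
      (_ : RiemannSurface Mbar) (_ : CompactSpace Mbar)
      (E : Set Mbar) (π : X → Mbar) (x : X → EuclideanSpace ℝ (Fin n))
      (hx : IsPseudoAlgebraic x E π),
      SimplyConnectedSpace X ∧ IsPuncturedPlane E ∧
      LinearlyNondegenerate (gaussMap hx.conformalImmersion) ∧
      ∃ L : Fin (n * (n + 1) / 2) → Module.Dual ℂ (Fin n → ℂ),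
        InGeneralPosition L ∧
        ∀ j, Disjoint (Set.range (gaussMap hx.conformalImmersion)) (hyperplane (L j)) := by
  obtain ⟨m, rfl⟩ := hn
  have hm : 0 < m := by omega
  obtain ⟨ι, _, v, A, hι, hA, hdeg, hroots, hindep⟩ :=
    exists_polynomials_anyIndependent (2 * m + 1) m
  have hAne : A.Nonempty := Finset.card_pos.1 (by omega)
  obtain ⟨x₀⟩ : Nonempty (PuncturedPlane A) := inferInstance
  choose! G hG using UniversalCovering.exists_logarithm (x₀ := x₀)
  have hx := isPseudoAlgebraic_curvePrimitive hm hA hG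
  have hgauss : ∀ (q : UniversalCovering x₀) (L : Module.Dual ℂ (Fin (2 * m + 1) → ℂ)),
      gaussMap hx.conformalImmersion q ∈ hyperplane L ↔
        (restrictForm m L).eval (UniversalCovering.coord q) = 0 := fun q =>
    gaussMap_mem_hyperplane_iff _ (inv_ne_zero (eval_nodal_ne_zero q.proj.2))
      (((isWeierstrassData_curvePrimitive hm hA hG).gaussVector_eq q).trans
        (curveForm_eq hA q.proj.2))
  have hcard : Fintype.card ι = (2 * m + 1) * (2 * m + 1 + 1) / 2 := by
    rw [hι, show 2 * m + 1 + 1 = (m + 1) * 2 by ring, ← mul_assoc,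
      Nat.mul_div_cancel _ two_pos]
  let e := (Fintype.equivFinOfCardEq hcard).symm
  choose L hL using fun j => exists_restrictForm_eq hm (hdeg (e j))
  refine ⟨UniversalCovering x₀, inferInstance, inferInstance, inferInstance, OnePoint ℂ,
    inferInstance, inferInstance, inferInstance, inferInstance, sphereEnds A, _, _, hx,
    inferInstance, isPuncturedPlane_sphereEnds hAne, fun L hL0 hsub => hL0 ?_, L,
    inGeneralPosition_of_anyIndependent hindep e hL, fun j => ?_⟩
  · refine eq_zero_of_eval_restrictForm (A := A) hm fun z hz => ?_
    obtain ⟨q, hq⟩ := UniversalCovering.surjective_proj (x₀ := x₀) ⟨z, hz⟩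
    have h := (hgauss q L).1 (hsub ⟨q, rfl⟩)
    rwa [UniversalCovering.coord, hq] at h
  · rw [Set.disjoint_left]
    rintro _ ⟨q, rfl⟩ hq
    have h := (hgauss q (L j)).1 hq
    rw [hL] at h
    exact hroots _ _ q.proj.2 h
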